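/- Let $L$ be a countable first-order language (for example, any language definable in Peano arithmetic) containing the language $\{0,S,+,\cdot\}$ of Peano arithmetic and interpreted in $\mathbb N$ so that these symbols have their standard meaning. Let $\mathcal M$ be a (non-standard) $\aleph_1$-saturated $L$-structure elementarily equivalent to $\mathbb N$. Let $\Omega\in\mathcal M$ be an infinite, $\mathcal M$-finite set, and let $F$ be a family of functions $\alpha:\Omega\to\mathcal M$ that are elements of (i.e. coded in) $\mathcal M$. Let $\mathcal B=\mathcal A/\mathcal I$, where $\mathcal A$ is the Boolean algebra of the subsets of $\Omega$ definable in $\mathcal M$ with parameters, and $\mathcal I$ is the ideal of the sets $U\in\mathcal A$ whose counting measure $|U|/|\Omega|$ (computed in $\mathcal M$) is infinitesimal. Let $L(F)$ be $L$ with a new constant for each element of $F$. The Boolean-valued structure $K(F)$ has universe $F$. The truth value $[\![A]\!]\in\mathcal B$ of an atomic $L(F)$-sentence $A$ is the class of the set of those $\omega\in\Omega$ such that $A$, with each constant $\alpha\in F$ interpreted as $\alpha(\omega)$, is true in $\mathcal M$; truth values commute with the Boolean connectives, and $[\![\exists x A(x)]\!]=\bigvee_{\alpha\in F}[\![A(\alpha)]\!]$,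 $[\![\forall x A(x)]\!]=\bigwedge_{\alpha\in F}[\![A(\alpha)]\!]$. Assume the following. 1. $F$ is $L$-closed: for every $k\ge 0$, every $k$-ary function symbol $f$ of $L$ and all $\alpha_1,\dots,\alpha_k\in F$, the function $\omega\mapsto f(\alpha_1(\omega),\dots,\alpha_k(\omega))$ is in $F$. 2. $F$ is closed under definitions by cases by open formulas: for all $\alpha,\beta\in F$ and every open (quantifier-free) $L(F)$-formula $B(x)$, there is $\gamma\in F$ such that, for all $\omega\in\Omega$, $\gamma(\omega)=\alpha(\omega)$ if $B(\alpha(\omega))$ holds at $\omega$, and $\gamma(\omega)=\beta(\omega)$ otherwise. 3. $F$ is compact: there is an $L$-formula $H(x,y)$, possibly with parameters from $\mathcal M$, such that the families $F_k$ of all functions $\Omega\to\mathcal M$ coded by some $b\in\mathcal M$ with $\mathcal M\models H(k,b)$ satisfy $F_k\supseteq F_{k+1}$ for all $k\in\mathbb N$ and $\bigcap_{k\in\mathbb N}F_k=F$. 4. $K(F)$ has pairing: $L$ contains unary function symbols $\pi_1,\pi_2$ and a binary function symbol $\langle\cdot,\cdot\rangle$ such that the universal closures of $\langle\pi_1(z),\pi_2(z)\rangle=z$,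 $\pi_1(\langle x,y\rangle)=x$ and $\pi_2(\langle x,y\rangle)=y$ have truth value $1_{\mathcal B}$. Then for every countable set $\mathbf p$ of existential $L(F)$-formulas in one free variable $x$, there is $\alpha\in F$ that realizes the saturation inequality for $\mathbf p$ in $K(F)$: $$\bigwedge_{\Phi\subseteq\mathbf p,\ \Phi\text{ finite}}\Big[\!\!\Big[\exists x\bigwedge_{A\in\Phi}A(x)\Big]\!\!\Big]\ \le\ \bigwedge_{A\in\mathbf p}[\![A(\alpha)]\!],$$ where in particular all the joins and meets of $\mathcal B$ that occur in these truth values and in the inequality exist. -/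

import Mathlib

open FirstOrder FirstOrder.Language

universe u v w

namespace RandomForcing

/-! ## Arithmetic inside a structure -/

/-- Function symbols of the language `{0, S, +, ·}` of Peano arithmetic. -/
inductive PeanoFunc : ℕ → Type
  | zero : PeanoFunc 0
  | succ : PeanoFunc 1
  | add : PeanoFunc 2
  | mul : PeanoFunc 2

/-- The language `{0, S, +, ·}` of Peano arithmetic. -/
def peano : FirstOrder.Language := ⟨PeanoFunc, fun _ => Empty⟩

/-- The standard model. -/
instance peanoStructureNat : peano.Structure ℕ where
  funMap {_} f x :=
    match f, x with
    | .zero, _ => 0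
    | .succ, x => x 0 + 1
    | .add, x => x 0 + x 1
    | .mul, x => x 0 * x 1
  RelMap {_} r _ := r.elim

section Arithmetic

variable {L : FirstOrder.Language.{u, v}} (ι : peano →ᴸ L) {M : Type w} [L.Structure M]

/-- The zero of `M`. -/
def zero : M := Structure.funMap (ι.onFunction PeanoFunc.zero) ![]

/-- The successor function of `M`. -/
def succ (x : M) : M := Structure.funMap (ι.onFunction PeanoFunc.succ) ![x]

/-- Addition of `M`. -/
def add (x y : M) : M := Structure.funMap (ι.onFunction PeanoFunc.add) ![x, y]

/-- Multiplication of `M`. -/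
def mul (x y : M) : M := Structure.funMap (ι.onFunction PeanoFunc.mul) ![x, y]

/-- The order `x ≤ y` of `M`, defined arithmetically. -/
def le (x y : M) : Prop := ∃ z : M, add ι x z = y

/-- The strict order `x < y` of `M`, defined arithmetically. -/
def lt (x y : M) : Prop := ∃ z : M, add ι x (succ ι z) = y

/-- The standard number `k` as an element of `M`. -/
def numeral : ℕ → M
  | 0 => zero ι
  | k + 1 => succ ι (numeral k)

/-- `b = ⟨c, d⟩` for the pairing function `Nat.pair`, as evaluated in `M`. -/
def PairRel (c d b : M) : Prop :=
  (lt ι c d ∧ b = add ι (mul ι d d) c) ∨ (le ι d c ∧ b = add ι (add ι (mul ι c c) c) d)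

/-- `Entry ι b i y`: the value at `i` of the function coded by `b ∈ M` is `y`, where functions
are coded by Gödel's `β`-function: `y` is the remainder of `c` modulo `1 + (1 + i) d`, for
`b = ⟨c, d⟩`. In `ℕ` this is `Nat.beta b i = y`. -/
def Entry (b i y : M) : Prop :=
  ∃ c d q : M, PairRel ι c d b ∧
    c = add ι (mul ι q (succ ι (mul ι (succ ι i) d))) y ∧ lt ι y (succ ι (mul ι (succ ι i) d))

/-- A subset of `M` is `M`-finite if it is bounded and definable with parameters. By induction
in `M`, these are exactly the sets that are coded by an element of `M`. -/
def MFinite (Ω : Set M) : Prop :=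
  (Set.univ : Set M).Definable₁ L Ω ∧ ∃ m : M, ∀ ω ∈ Ω, lt ι ω m

/-- The element `b` of `M` codes the function `α : Ω → M`. -/
def Codes {Ω : Set M} (b : M) (α : Ω → M) : Prop := ∀ ω : Ω, Entry ι b ω (α ω)

/-- The set `U ⊆ Ω` has exactly `n` elements in the sense of `M`: some function in `M` maps it
bijectively onto `{i | i < n}`. -/
def HasMCard {Ω : Set M} (U : Set Ω) (n : M) : Prop :=
  ∃ (b : M) (f : Ω → M), Codes ι b f ∧ Set.BijOn f U {i | lt ι i n}

/-- The counting measure `|U| / |Ω|` of `U ⊆ Ω` is infinitesimal: `k |U| ≤ |Ω|` in `M` for every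
standard number `k`. -/
def Infinitesimal {Ω : Set M} (U : Set Ω) : Prop :=
  ∃ m n : M, HasMCard ι U m ∧ HasMCard ι (Set.univ : Set Ω) n ∧
    ∀ k : ℕ, le ι (mul ι (numeral ι k) m) n

end Arithmetic

/-! ## Saturation of the ambient model -/

/-- `M` is `ℵ₁`-saturated: every finitely satisfiable set of formulas in one variable with
parameters from a countable set is satisfied by an element of `M`. -/
def Aleph1Saturated (L : FirstOrder.Language.{u, v}) (M : Type w) [L.Structure M] : Prop :=
  ∀ C : Set M, C.Countable → ∀ q : Set (L[[C]].Formula (Fin 1)),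
    (∀ Φ : Finset (L[[C]].Formula (Fin 1)), (Φ : Set (L[[C]].Formula (Fin 1))) ⊆ q →
      ∃ x : M, ∀ A ∈ Φ, A.Realize fun _ => x) →
    ∃ x : M, ∀ A ∈ q, A.Realize fun _ => x

/-! ## The Boolean algebra of truth values -/

/-- The Boolean algebra of `M`-definable (with parameters) subsets of `Ω`. It is given here by the
traces on `Ω` of definable subsets of `M`, which is the same because `Ω` will be definable. -/
def events (L : FirstOrder.Language.{u, v}) {M : Type w} [L.Structure M] (Ω : Set M) :
    BooleanSubalgebra (Set Ω) where
  carrier := {U | ∃ D : Set M, (Set.univ : Set M).Definable₁ L D ∧ U = Subtype.val ⁻¹' D}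
  supClosed' := by
    rintro _ ⟨D, hD, rfl⟩ _ ⟨E, hE, rfl⟩
    exact ⟨D ∪ E, Set.Definable.union hD hE, rfl⟩
  infClosed' := by
    rintro _ ⟨D, hD, rfl⟩ _ ⟨E, hE, rfl⟩
    exact ⟨D ∩ E, Set.Definable.inter hD hE, rfl⟩
  compl_mem' := by
    rintro _ ⟨D, hD, rfl⟩
    exact ⟨Dᶜ, Set.Definable.compl hD, rfl⟩
  bot_mem' := ⟨∅, Set.definable_empty, rfl⟩

section TruthValues

variable {L : FirstOrder.Language.{u, v}} (ι : peano →ᴸ L) {M : Type w} [L.Structure M]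

/-- The ideal of definable subsets of `Ω` of infinitesimal counting measure, in the Boolean
algebra of definable subsets seen as a Boolean ring. (These sets form an ideal, so the ideal that
they generate consists of them only.) -/
def nullIdeal (Ω : Set M) : Ideal (AsBoolRing (events L Ω)) :=
  Ideal.span {U : AsBoolRing (events L Ω) | Infinitesimal ι (ofBoolRing U).1}

instance quotientBooleanRing (Ω : Set M) :
    BooleanRing (AsBoolRing (events L Ω) ⧸ nullIdeal ι Ω) where
  isIdempotentElem a := by
    obtain ⟨U, rfl⟩ := Ideal.Quotient.mk_surjective a
    exact (map_mul (Ideal.Quotient.mk (nullIdeal ι Ω)) U U).symm.trans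
      (congrArg _ (BooleanRing.isIdempotentElem U))

/-- The Boolean algebra of truth values: definable subsets of `Ω` modulo sets of infinitesimal
counting measure. -/
abbrev TruthAlgebra (Ω : Set M) : Type w :=
  AsBoolAlg (AsBoolRing (events L Ω) ⧸ nullIdeal ι Ω)

/-- The class `U / I` of a definable set `U ⊆ Ω`. -/
def eventClass {Ω : Set M} (U : events L Ω) : TruthAlgebra ι Ω :=
  toBoolAlg (Ideal.Quotient.mk (nullIdeal ι Ω) (toBoolRing U))

/-- `b` is the class of the set `U ⊆ Ω` (which is then definable). -/
def IsClassOf {Ω : Set M} (U : Set Ω) (b : TruthAlgebra ι Ω) : Prop :=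
  ∃ h : U ∈ events L Ω, b = eventClass ι ⟨U, h⟩

/-- The interpretation of the language `L(F)` in `M` at the sample `ω`: symbols of `L` are
interpreted as in `M`, and the constant for `α ∈ F` is interpreted by `α(ω)`. -/
abbrev sampleStructure {Ω : Set M} (F : Set (Ω → M)) (ω : Ω) : L[[F]].Structure M :=
  letI : (constantsOn F).Structure M := constantsOn.structure fun α => (α : Ω → M) ω
  FirstOrder.Language.sumStructure L (constantsOn F) M

/-- `HasTruthValue ι F A xs b`: the truth value `⟦A(xs)⟧` in the Boolean-valued structure `K(F)` of
the `L(F)`-formula `A`, with elements `xs` of `F` for its free variables, is `b`. An atomic sentence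
has as value the class of the set of samples at which it is true, values commute with connectives,
and the value of a universal sentence is the meet of the values of its instances (the formulas are
built from `⊥`, `→`, `∀`, and `∃` is `¬∀¬`; see `hasTruthValue_ex`). -/
def HasTruthValue {Ω : Set M} (F : Set (Ω → M)) :
    ∀ {n : ℕ}, L[[F]].BoundedFormula Empty n → (Fin n → F) → TruthAlgebra ι Ω → Prop
  | _, .falsum, _, b => b = ⊥
  | _, .equal t₁ t₂, xs, b =>
      IsClassOf ι {ω | letI := sampleStructure (L := L) F ω
        t₁.realize (Sum.elim Empty.elim fun i => (xs i : Ω → M) ω) =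
        t₂.realize (Sum.elim Empty.elim fun i => (xs i : Ω → M) ω)} b
  | _, .rel R ts, xs, b =>
      IsClassOf ι {ω | letI := sampleStructure (L := L) F ω
        Structure.RelMap R fun j =>
          (ts j).realize (Sum.elim Empty.elim fun i => (xs i : Ω → M) ω)} b
  | _, .imp A B, xs, b =>
      ∃ b₁ b₂, HasTruthValue F A xs b₁ ∧ HasTruthValue F B xs b₂ ∧ b = b₁ ⇨ b₂
  | _, .all A, xs, b =>
      ∃ g : F → TruthAlgebra ι Ω,
        (∀ α : F, HasTruthValue F A (Fin.snoc xs α) (g α)) ∧ IsGLB (Set.range g) b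

variable {ι}

/-- Truth values are unique. -/
theorem HasTruthValue.unique {Ω : Set M} {F : Set (Ω → M)} {n : ℕ}
    {A : L[[F]].BoundedFormula Empty n} {xs : Fin n → F} {b c : TruthAlgebra ι Ω}
    (hb : HasTruthValue ι F A xs b) (hc : HasTruthValue ι F A xs c) : b = c := by
  induction A generalizing b c with
  | falsum => exact Eq.trans hb (Eq.symm hc)
  | equal t₁ t₂ =>
    obtain ⟨_, rfl⟩ := hb
    obtain ⟨_, rfl⟩ := hc
    rfl
  | rel R ts =>
    obtain ⟨_, rfl⟩ := hb
    obtain ⟨_, rfl⟩ := hc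
    rfl
  | imp A B ihA ihB =>
    obtain ⟨b₁, b₂, h₁, h₂, rfl⟩ := hb
    obtain ⟨c₁, c₂, k₁, k₂, rfl⟩ := hc
    rw [ihA h₁ k₁, ihB h₂ k₂]
  | all A ih =>
    obtain ⟨g, hg, hgb⟩ := hb
    obtain ⟨g', hg', hgc⟩ := hc
    have : g = g' := funext fun α => ih (hg α) (hg' α)
    subst this
    exact hgb.unique hgc

/-- The value of an existential sentence is the join of the values of its instances. -/
theorem hasTruthValue_ex {Ω : Set M} {F : Set (Ω → M)} {n : ℕ}
    {A : L[[F]].BoundedFormula Empty (n + 1)} {xs : Fin n → F} {b : TruthAlgebra ι Ω} :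
    HasTruthValue ι F A.ex xs b ↔ ∃ g : F → TruthAlgebra ι Ω,
      (∀ α : F, HasTruthValue ι F A (Fin.snoc xs α) (g α)) ∧ IsLUB (Set.range g) b := by
  constructor
  · rintro ⟨b₁, b₂, ⟨g, hg, hgb⟩, h₂, rfl⟩
    have h₂' : b₂ = ⊥ := h₂
    subst h₂'
    choose g₁ g₂ h₁ h₂ h₃ using hg
    have e : ∀ α, g α = (g₁ α)ᶜ := fun α => by
      rw [h₃ α, show g₂ α = ⊥ from h₂ α, himp_bot]
    refine ⟨g₁, h₁, ?_, ?_⟩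
    · rintro _ ⟨α, rfl⟩
      rw [himp_bot, le_compl_iff_le_compl, ← e]
      exact hgb.1 ⟨α, rfl⟩
    · intro c hc
      rw [himp_bot, compl_le_iff_compl_le]
      refine hgb.2 ?_
      rintro _ ⟨α, rfl⟩
      rw [e]
      exact compl_le_compl (hc ⟨α, rfl⟩)
  · rintro ⟨g, hg, hgb⟩
    refine ⟨bᶜ, ⊥, ⟨fun α => (g α)ᶜ, fun α => ⟨g α, ⊥, hg α, rfl, by rw [himp_bot]⟩, ?_, ?_⟩,
      rfl, by rw [himp_bot, compl_compl]⟩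
    · rintro _ ⟨α, rfl⟩
      exact compl_le_compl (hgb.1 ⟨α, rfl⟩)
    · intro c hc
      rw [← compl_le_compl_iff_le, compl_compl]
      refine hgb.2 ?_
      rintro _ ⟨α, rfl⟩
      rw [le_compl_iff_le_compl]
      exact hc ⟨α, rfl⟩

end TruthValues

/-! ## Families of random variables -/

section Families

variable {L : FirstOrder.Language.{u, v}} (ι : peano →ᴸ L) {M : Type w} [L.Structure M] {Ω : Set M}

/-- `F` is `L`-closed: it is closed under pointwise application of the functions of `L`
(including the constants). -/
def LClosed (L : FirstOrder.Language.{u, v}) {M : Type w} [L.Structure M] {Ω : Set M}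
    (F : Set (Ω → M)) : Prop :=
  ∀ (n : ℕ) (f : L.Functions n) (a : Fin n → Ω → M), (∀ i, a i ∈ F) →
    (fun ω => Structure.funMap f fun i => a i ω) ∈ F

/-- `F` is closed under definitions by cases by open formulas: for `α, β ∈ F` and any open
`L(F)`-formula `B(x)`, the function equal to `α(ω)` if `B(α(ω))` holds and to `β(ω)` otherwise is
in `F`. -/
def ClosedUnderCases (L : FirstOrder.Language.{u, v}) {M : Type w} [L.Structure M] {Ω : Set M}
    (F : Set (Ω → M)) : Prop :=
  ∀ α ∈ F, ∀ β ∈ F, ∀ B : L[[F]].BoundedFormula Empty 1, B.IsQF →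
    ∃ γ ∈ F, ∀ ω : Ω,
      letI := sampleStructure (L := L) F ω
      (B.Realize Empty.elim (fun _ => α ω) → γ ω = α ω) ∧
      (¬ B.Realize Empty.elim (fun _ => α ω) → γ ω = β ω)

/-- The functions `Ω → M` that are coded by an element `b` of `M` with `M ⊨ H(a, b)`. -/
def definedFamily (Ω : Set M) (H : L[[M]].Formula (Fin 2)) (a : M) : Set (Ω → M) :=
  {α | ∃ b : M, Codes ι b α ∧ H.Realize ![a, b]}

/-- `F` is compact: for some formula `H(x, y)` of `L`, with parameters from `M`, the families `F_k`
defined by `H(k, y)` for standard `k` are decreasing and have intersection `F`. -/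
def Compact (F : Set (Ω → M)) : Prop :=
  ∃ H : L[[M]].Formula (Fin 2),
    (⋂ k : ℕ, definedFamily ι Ω H (numeral ι k)) = F ∧
    ∀ k : ℕ, definedFamily ι Ω H (numeral ι (k + 1)) ⊆ definedFamily ι Ω H (numeral ι k)

/-- The `L`-sentence `A` is valid in `K(F)`. -/
def Valid (F : Set (Ω → M)) (A : L.Sentence) : Prop :=
  HasTruthValue ι F ((L.lhomWithConstants F).onSentence A) Fin.elim0 ⊤

/-- `K(F)` has pairing: `L` has symbols for a pairing function and its two projections, and the
defining identities are valid in `K(F)`. -/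
def HasPairing (F : Set (Ω → M)) : Prop :=
  ∃ (π₁ π₂ : L.Functions 1) (p : L.Functions 2),
    Valid ι F (BoundedFormula.all
      ((p.apply₂ (π₁.apply₁ (&0)) (π₂.apply₁ (&0))).bdEqual (&0) :
        L.BoundedFormula Empty 1)) ∧
    Valid ι F (BoundedFormula.all (BoundedFormula.all
      ((π₁.apply₁ (p.apply₂ (&0) (&1))).bdEqual (&0) : L.BoundedFormula Empty 2))) ∧
    Valid ι F (BoundedFormula.all (BoundedFormula.all
      ((π₂.apply₁ (p.apply₂ (&0) (&1))).bdEqual (&1) : L.BoundedFormula Empty 2)))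

/-- `α ∈ F` realizes the saturation inequality for the set `p` of formulas in one free variable:
all the truth values in it exist, and
`⋀ {⟦∃ x ⋀_{A ∈ Φ} A(x)⟧ | Φ ⊆ p finite} ≤ ⋀ {⟦A(α)⟧ | A ∈ p}`. -/
def RealizesSatur (F : Set (Ω → M)) (p : Set (L[[F]].BoundedFormula Empty 1)) (α : F) : Prop :=
  ∃ (s : {Φ : Finset (L[[F]].BoundedFormula Empty 1) // ↑Φ ⊆ p} → TruthAlgebra ι Ω)
    (t : p → TruthAlgebra ι Ω) (l r : TruthAlgebra ι Ω),
    (∀ Φ, HasTruthValue ι F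
      (BoundedFormula.iInf fun A : Φ.1 => A.1).ex Fin.elim0 (s Φ)) ∧
    (∀ A, HasTruthValue ι F A.1 (fun _ => α) (t A)) ∧
    IsGLB (Set.range s) l ∧ IsGLB (Set.range t) r ∧ l ≤ r

end Families

end RandomForcing

/-! The value of an existential formula is a join that is attained. Write such a formula as `∃ y,
B(x, y)` with `B` open. Gluing two tuples of witnesses along `B`, by definition by cases, shows that
the truth sets of `B(x, y)`, for `y` in `F`, form a directed family. Counting then gives, for each
standard `k`, a truth set that no other one exceeds by more than `|Ω| / k`: otherwise `k + 1`
successive increments would outgrow `Ω`. Compactness expresses "codes a member of `F`" by countably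
many definable conditions, so saturation produces witnesses whose truth set is maximal up to an
infinitesimal set (`exists_maximal`, `exists_maximal_truthSet`, `exists_hasMatrix`). The same
principle, applied to codes of events, gives countable meets in the truth algebra (`exists_isGLB`).

For the set `p`, each formula receives its own block of witness variables, all blocks sharing `x`.
Let `U` represent the left-hand side of the inequality. Witnesses that maximize the conjunction over
a finite `Φ` make `U` infinitesimally contained in the truth set of each matrix from `Φ`. For every
`k`, "contained up to `|Ω| / k`" is definable, so saturation yields one tuple that serves all of
`p`; its `x`-coordinate is `α`. Countable tuples are coded by single elements of `M`
(`exists_code_sequence`), so saturation in one variable suffices.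

The facts on internal counting are proved for finite sets of natural numbers and moved to `M` by
elementary equivalence (`Corr.transfer`, `countingFacts`). -/

namespace RandomForcing

/-! ### Relations defined by one formula in two structures, and transfer -/

section Correspondence

variable (L : FirstOrder.Language.{u, v}) {N₁ N₂ : Type*} [L.Structure N₁] [L.Structure N₂]
  {α β : Type*}

/-- The relations `P₁` on `N₁` and `P₂` on `N₂` are defined by the same formula of `L`. -/
def Corr (P₁ : (α → N₁) → Prop) (P₂ : (α → N₂) → Prop) : Prop :=
  ∃ φ : L.Formula α, (∀ v, φ.Realize v ↔ P₁ v) ∧ ∀ v, φ.Realize v ↔ P₂ v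

/-- The functions `f₁` on `N₁` and `f₂` on `N₂` are defined by the same term of `L`. -/
def CorrTerm (f₁ : (α → N₁) → N₁) (f₂ : (α → N₂) → N₂) : Prop :=
  ∃ t : L.Term α, (∀ v, t.realize v = f₁ v) ∧ ∀ v, t.realize v = f₂ v

variable {L} {P₁ Q₁ : (α → N₁) → Prop} {P₂ Q₂ : (α → N₂) → Prop}
  {f₁ g₁ : (α → N₁) → N₁} {f₂ g₂ : (α → N₂) → N₂}

theorem Corr.not (h : Corr L P₁ P₂) : Corr L (fun v => ¬P₁ v) (fun v => ¬P₂ v) := by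
  obtain ⟨φ, h₁, h₂⟩ := h
  exact ⟨φ.not, fun v => by simp [h₁], fun v => by simp [h₂]⟩

theorem Corr.and (h : Corr L P₁ P₂) (k : Corr L Q₁ Q₂) :
    Corr L (fun v => P₁ v ∧ Q₁ v) (fun v => P₂ v ∧ Q₂ v) := by
  obtain ⟨φ, h₁, h₂⟩ := h
  obtain ⟨ψ, k₁, k₂⟩ := k
  exact ⟨φ ⊓ ψ, fun v => by simp [h₁, k₁], fun v => by simp [h₂, k₂]⟩

theorem Corr.or (h : Corr L P₁ P₂) (k : Corr L Q₁ Q₂) :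
    Corr L (fun v => P₁ v ∨ Q₁ v) (fun v => P₂ v ∨ Q₂ v) := by
  obtain ⟨φ, h₁, h₂⟩ := h
  obtain ⟨ψ, k₁, k₂⟩ := k
  exact ⟨φ ⊔ ψ, fun v => by simp [h₁, k₁], fun v => by simp [h₂, k₂]⟩

theorem Corr.imp (h : Corr L P₁ P₂) (k : Corr L Q₁ Q₂) :
    Corr L (fun v => P₁ v → Q₁ v) (fun v => P₂ v → Q₂ v) := by
  obtain ⟨φ, h₁, h₂⟩ := h
  obtain ⟨ψ, k₁, k₂⟩ := k
  exact ⟨φ.imp ψ, fun v => by simp [h₁, k₁], fun v => by simp [h₂, k₂]⟩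

theorem Corr.iff (h : Corr L P₁ P₂) (k : Corr L Q₁ Q₂) :
    Corr L (fun v => P₁ v ↔ Q₁ v) (fun v => P₂ v ↔ Q₂ v) := by
  obtain ⟨φ, h₁, h₂⟩ := h
  obtain ⟨ψ, k₁, k₂⟩ := k
  exact ⟨φ.iff ψ, fun v => by simp [h₁, k₁], fun v => by simp [h₂, k₂]⟩

/-- The variable to be bound is `none` in `Option α`. With this convention a proof that a statement
is first-order follows the syntax of the statement, and no formula is written out. -/
theorem Corr.all {P₁ : (α → N₁) → N₁ → Prop} {P₂ : (α → N₂) → N₂ → Prop}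
    (h : Corr L (fun v : Option α → N₁ => P₁ (fun a => v (some a)) (v none))
      (fun v : Option α → N₂ => P₂ (fun a => v (some a)) (v none))) :
    Corr L (fun v => ∀ x, P₁ v x) (fun v => ∀ x, P₂ v x) := by
  obtain ⟨φ, h₁, h₂⟩ := h
  refine ⟨Formula.iAlls Unit (φ.relabel fun o => o.elim (.inr ()) .inl), fun v => ?_, fun v => ?_⟩
  · simp only [Formula.realize_iAlls, Formula.realize_relabel, h₁]
    exact ⟨fun h x => h fun _ => x, fun h x => h (x ())⟩
  · simp only [Formula.realize_iAlls, Formula.realize_relabel, h₂]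
    exact ⟨fun h x => h fun _ => x, fun h x => h (x ())⟩

theorem Corr.ex {P₁ : (α → N₁) → N₁ → Prop} {P₂ : (α → N₂) → N₂ → Prop}
    (h : Corr L (fun v : Option α → N₁ => P₁ (fun a => v (some a)) (v none))
      (fun v : Option α → N₂ => P₂ (fun a => v (some a)) (v none))) :
    Corr L (fun v => ∃ x, P₁ v x) (fun v => ∃ x, P₂ v x) := by
  obtain ⟨φ, h₁, h₂⟩ := h
  refine ⟨Formula.iExs Unit (φ.relabel fun o => o.elim (.inr ()) .inl), fun v => ?_, fun v => ?_⟩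
  · simp only [Formula.realize_iExs, Formula.realize_relabel, h₁]
    exact ⟨fun ⟨x, h⟩ => ⟨x (), h⟩, fun ⟨x, h⟩ => ⟨fun _ => x, h⟩⟩
  · simp only [Formula.realize_iExs, Formula.realize_relabel, h₂]
    exact ⟨fun ⟨x, h⟩ => ⟨x (), h⟩, fun ⟨x, h⟩ => ⟨fun _ => x, h⟩⟩

theorem Corr.true : Corr L (fun _ : α → N₁ => True) (fun _ : α → N₂ => True) :=
  ⟨⊤, by simp, by simp⟩

theorem Corr.forall_lt {P₁ : ℕ → (α → N₁) → Prop} {P₂ : ℕ → (α → N₂) → Prop} (n : ℕ)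
    (h : ∀ i, Corr L (P₁ i) (P₂ i)) :
    Corr L (fun v => ∀ i < n, P₁ i v) (fun v => ∀ i < n, P₂ i v) := by
  induction n with
  | zero => simpa using Corr.true
  | succ n ih => simpa only [Nat.forall_lt_succ_right] using ih.and (h n)

theorem Corr.eq (h : CorrTerm L f₁ f₂) (k : CorrTerm L g₁ g₂) :
    Corr L (fun v => f₁ v = g₁ v) (fun v => f₂ v = g₂ v) := by
  obtain ⟨s, h₁, h₂⟩ := h
  obtain ⟨t, k₁, k₂⟩ := k
  exact ⟨s.equal t, fun v => by simp [h₁, k₁], fun v => by simp [h₂, k₂]⟩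

theorem CorrTerm.var (a : α) :
    CorrTerm L (fun v : α → N₁ => v a) (fun v : α → N₂ => v a) :=
  ⟨Language.var a, fun _ => rfl, fun _ => rfl⟩

/-- Substitution of a term for the distinguished variable. -/
theorem Corr.app {P₁ : (α → N₁) → N₁ → Prop} {P₂ : (α → N₂) → N₂ → Prop}
    (h : Corr L (fun v : Option α → N₁ => P₁ (fun a => v (some a)) (v none))
      (fun v : Option α → N₂ => P₂ (fun a => v (some a)) (v none))) (e : α → β)
    {f₁ : (β → N₁) → N₁} {f₂ : (β → N₂) → N₂} (k : CorrTerm L f₁ f₂) :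
    Corr L (fun v : β → N₁ => P₁ (fun a => v (e a)) (f₁ v))
      (fun v : β → N₂ => P₂ (fun a => v (e a)) (f₂ v)) := by
  obtain ⟨φ, h₁, h₂⟩ := h
  obtain ⟨t, k₁, k₂⟩ := k
  refine ⟨φ.subst fun o => o.elim t fun a => Language.var (e a), fun v => ?_, fun v => ?_⟩
  · beta_reduce
    rw [Formula.Realize, BoundedFormula.realize_subst, ← k₁]
    exact h₁ _
  · beta_reduce
    rw [Formula.Realize, BoundedFormula.realize_subst, ← k₂]
    exact h₂ _

theorem Corr.comp (h : Corr L P₁ P₂) (e : α → β) :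
    Corr L (fun v : β → N₁ => P₁ fun a => v (e a)) (fun v : β → N₂ => P₂ fun a => v (e a)) := by
  obtain ⟨φ, h₁, h₂⟩ := h
  exact ⟨φ.relabel e, fun v => by rw [Formula.realize_relabel]; exact h₁ _,
    fun v => by rw [Formula.realize_relabel]; exact h₂ _⟩

/-- Transfer between elementarily equivalent structures. -/
theorem Corr.transfer [Nonempty N₁] (h : Corr L P₁ P₂) (hN : L.ElementarilyEquivalent N₁ N₂)
    (hP : ∀ v, P₁ v) (v : α → N₂) : P₂ v := by
  classical
  obtain ⟨φ, h₁, h₂⟩ := h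
  -- The index type `α` may be infinite, so only the finitely many variables that occur in `φ` are
  -- quantified.
  let ψ : L.Sentence := Formula.iAlls φ.freeVarFinset (φ.restrictFreeVar (Sum.inr (α := Empty)))
  have hψ : N₁ ⊨ ψ := by
    rw [Sentence.Realize, Formula.realize_iAlls]
    intro x
    refine (BoundedFormula.realize_restrictFreeVar (fun a => if ha : a ∈ φ.freeVarFinset then
      x ⟨a, ha⟩ else Classical.arbitrary N₁) fun a => ?_).2 ((h₁ _).2 (hP _))
    simp
  rw [hN.realize_sentence, Sentence.Realize, Formula.realize_iAlls] at hψ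
  refine (h₂ v).1 ((BoundedFormula.realize_restrictFreeVar (f := Sum.inr (α := Empty)) v
    fun a => ?_).1 (hψ fun a => v a))
  rfl

end Correspondence

/-! ### Arithmetic, coding and counting are first-order -/

section ArithmeticCorrespondence

variable {L : FirstOrder.Language.{u, v}} (ι : peano →ᴸ L)

/-- In the sense of the structure, the set `D` has exactly `n` elements. -/
def InternalCard {N : Type*} [L.Structure N] (D : N → Prop) (n : N) : Prop :=
  ∃ b, (∀ x, D x → ∃ y, Entry ι b x y ∧ lt ι y n) ∧
    (∀ x x' y, D x → D x' → Entry ι b x y → Entry ι b x' y → x = x') ∧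
    ∀ y, lt ι y n → ∃ x, D x ∧ Entry ι b x y

/-- In the sense of the structure, `k |D| ≤ |Ω|`. -/
def Small {N : Type*} [L.Structure N] (k : ℕ) (D Ω : N → Prop) : Prop :=
  ∃ m n, InternalCard ι D m ∧ InternalCard ι Ω n ∧ le ι (mul ι (numeral ι k) m) n

/-- In the sense of the structure, `j |Ω| ≤ k |D|`. -/
def Large {N : Type*} [L.Structure N] (j k : ℕ) (D Ω : N → Prop) : Prop :=
  ∃ m n, InternalCard ι D m ∧ InternalCard ι Ω n ∧
    le ι (mul ι (numeral ι j) n) (mul ι (numeral ι k) m)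

variable {N₁ N₂ : Type*} [L.Structure N₁] [L.Structure N₂] {α : Type*}
  {f₁ g₁ h₁ : (α → N₁) → N₁} {f₂ g₂ h₂ : (α → N₂) → N₂}

theorem CorrTerm.zero :
    CorrTerm L (fun _ : α → N₁ => RandomForcing.zero ι) (fun _ : α → N₂ => RandomForcing.zero ι) :=
  ⟨Term.func (ι.onFunction PeanoFunc.zero) ![],
    fun _ => congrArg (Structure.funMap _) (Subsingleton.elim _ _),
    fun _ => congrArg (Structure.funMap _) (Subsingleton.elim _ _)⟩

variable {ι}

theorem CorrTerm.succ (hf : CorrTerm L f₁ f₂) :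
    CorrTerm L (fun v => RandomForcing.succ ι (f₁ v)) (fun v => RandomForcing.succ ι (f₂ v)) := by
  obtain ⟨s, s₁, s₂⟩ := hf
  exact ⟨(ι.onFunction PeanoFunc.succ).apply₁ s,
    fun v => by rw [Term.realize_functions_apply₁, s₁]; rfl,
    fun v => by rw [Term.realize_functions_apply₁, s₂]; rfl⟩

theorem CorrTerm.add (hf : CorrTerm L f₁ f₂) (hg : CorrTerm L g₁ g₂) :
    CorrTerm L (fun v => RandomForcing.add ι (f₁ v) (g₁ v))
      (fun v => RandomForcing.add ι (f₂ v) (g₂ v)) := by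
  obtain ⟨s, s₁, s₂⟩ := hf
  obtain ⟨t, t₁, t₂⟩ := hg
  exact ⟨(ι.onFunction PeanoFunc.add).apply₂ s t,
    fun v => by rw [Term.realize_functions_apply₂, s₁, t₁]; rfl,
    fun v => by rw [Term.realize_functions_apply₂, s₂, t₂]; rfl⟩

theorem CorrTerm.mul (hf : CorrTerm L f₁ f₂) (hg : CorrTerm L g₁ g₂) :
    CorrTerm L (fun v => RandomForcing.mul ι (f₁ v) (g₁ v))
      (fun v => RandomForcing.mul ι (f₂ v) (g₂ v)) := by
  obtain ⟨s, s₁, s₂⟩ := hf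
  obtain ⟨t, t₁, t₂⟩ := hg
  exact ⟨(ι.onFunction PeanoFunc.mul).apply₂ s t,
    fun v => by rw [Term.realize_functions_apply₂, s₁, t₁]; rfl,
    fun v => by rw [Term.realize_functions_apply₂, s₂, t₂]; rfl⟩

theorem CorrTerm.numeral (k : ℕ) :
    CorrTerm L (fun _ : α → N₁ => RandomForcing.numeral ι k)
      (fun _ : α → N₂ => RandomForcing.numeral ι k) := by
  induction k with
  | zero => exact CorrTerm.zero ι
  | succ k ih => exact ih.succ

theorem CorrTerm.lift (h : CorrTerm L f₁ f₂) :
    CorrTerm L (fun v : Option α → N₁ => f₁ fun a => v (some a))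
      (fun v : Option α → N₂ => f₂ fun a => v (some a)) := by
  obtain ⟨t, t₁, t₂⟩ := h
  exact ⟨t.relabel some, fun v => by rw [Term.realize_relabel, t₁]; rfl,
    fun v => by rw [Term.realize_relabel, t₂]; rfl⟩

theorem Corr.le (hf : CorrTerm L f₁ f₂) (hg : CorrTerm L g₁ g₂) :
    Corr L (fun v => RandomForcing.le ι (f₁ v) (g₁ v))
      (fun v => RandomForcing.le ι (f₂ v) (g₂ v)) :=
  .ex (.eq (hf.lift.add (.var _)) hg.lift)

theorem Corr.lt (hf : CorrTerm L f₁ f₂) (hg : CorrTerm L g₁ g₂) :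
    Corr L (fun v => RandomForcing.lt ι (f₁ v) (g₁ v))
      (fun v => RandomForcing.lt ι (f₂ v) (g₂ v)) :=
  .ex (.eq (hf.lift.add (.succ (.var _))) hg.lift)

theorem Corr.entry (hf : CorrTerm L f₁ f₂) (hg : CorrTerm L g₁ g₂) (hh : CorrTerm L h₁ h₂) :
    Corr L (fun v => Entry ι (f₁ v) (g₁ v) (h₁ v)) (fun v => Entry ι (f₂ v) (g₂ v) (h₂ v)) := by
  have hf' := hf.lift.lift.lift
  have hg' := hg.lift.lift.lift
  have hh' := hh.lift.lift.lift
  have hc := CorrTerm.var (L := L) (N₁ := N₁) (N₂ := N₂) (some (some (none : Option α)))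
  have hd := CorrTerm.var (L := L) (N₁ := N₁) (N₂ := N₂) (some (none : Option (Option α)))
  have hq := CorrTerm.var (L := L) (N₁ := N₁) (N₂ := N₂) (none : Option (Option (Option α)))
  have hs : CorrTerm L _ _ := .succ (ι := ι) (.mul (ι := ι) (.succ (ι := ι) hg') hd)
  exact .ex (.ex (.ex (.and (.or (.and (.lt hc hd) (.eq hf' (.add (.mul hd hd) hc)))
    (.and (.le hd hc) (.eq hf' (.add (.add (.mul hc hc) hc) hd))))
    (.and (.eq hc (.add (.mul hq hs) hh')) (.lt hh' hs)))))

theorem Corr.internalCard {D₁ : (α → N₁) → N₁ → Prop} {D₂ : (α → N₂) → N₂ → Prop}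
    (h : Corr L (fun v : Option α → N₁ => D₁ (fun a => v (some a)) (v none))
      (fun v : Option α → N₂ => D₂ (fun a => v (some a)) (v none)))
    (hf : CorrTerm L f₁ f₂) :
    Corr L (fun v => InternalCard ι (D₁ v) (f₁ v)) (fun v => InternalCard ι (D₂ v) (f₂ v)) := by
  refine .ex (.and (.all (.imp (h.app (fun a => some (some a)) (.var _)) (.ex (.and
    (.entry (.var _) (.var _) (.var _)) (.lt (.var _) hf.lift.lift.lift))))) (.and ?_ ?_))
  · exact .all (.all (.all (.imp (h.app (fun a => some (some (some (some a)))) (.var _))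
      (.imp (h.app (fun a => some (some (some (some a)))) (.var _)) (.imp
        (.entry (.var _) (.var _) (.var _)) (.imp
        (.entry (.var _) (.var _) (.var _)) (.eq (.var _) (.var _))))))))
  · exact .all (.imp (.lt (.var _) hf.lift.lift) (.ex (.and
      (h.app (fun a => some (some (some a))) (.var _)) (.entry (.var _) (.var _) (.var _)))))

variable {D₁ E₁ : (α → N₁) → N₁ → Prop} {D₂ E₂ : (α → N₂) → N₂ → Prop}

theorem Corr.lift (h : Corr L (fun v : Option α → N₁ => D₁ (fun a => v (some a)) (v none))
      (fun v : Option α → N₂ => D₂ (fun a => v (some a)) (v none))) :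
    Corr L (fun v : Option (Option α) → N₁ => D₁ (fun a => v (some (some a))) (v none))
      (fun v : Option (Option α) → N₂ => D₂ (fun a => v (some (some a))) (v none)) :=
  h.app (fun a => some (some a)) (.var _)

theorem Corr.small (hD : Corr L (fun v : Option α → N₁ => D₁ (fun a => v (some a)) (v none))
      (fun v : Option α → N₂ => D₂ (fun a => v (some a)) (v none)))
    (hE : Corr L (fun v : Option α → N₁ => E₁ (fun a => v (some a)) (v none))
      (fun v : Option α → N₂ => E₂ (fun a => v (some a)) (v none))) (k : ℕ) :
    Corr L (fun v => Small ι k (D₁ v) (E₁ v)) (fun v => Small ι k (D₂ v) (E₂ v)) := by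
  have hD' := hD.lift.lift (D₁ := fun v => D₁ fun a => v (some a))
    (D₂ := fun v => D₂ fun a => v (some a))
  have hE' := hE.lift.lift (D₁ := fun v => E₁ fun a => v (some a))
    (D₂ := fun v => E₂ fun a => v (some a))
  exact .ex (.ex (.and (hD'.internalCard (D₁ := fun v => D₁ fun a => v (some (some a)))
    (D₂ := fun v => D₂ fun a => v (some (some a))) (.var _)) (.and
    (hE'.internalCard (D₁ := fun v => E₁ fun a => v (some (some a)))
    (D₂ := fun v => E₂ fun a => v (some (some a))) (.var _))
    (.le (.mul (.numeral k) (.var _)) (.var _)))))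

theorem Corr.large (hD : Corr L (fun v : Option α → N₁ => D₁ (fun a => v (some a)) (v none))
      (fun v : Option α → N₂ => D₂ (fun a => v (some a)) (v none)))
    (hE : Corr L (fun v : Option α → N₁ => E₁ (fun a => v (some a)) (v none))
      (fun v : Option α → N₂ => E₂ (fun a => v (some a)) (v none))) (j k : ℕ) :
    Corr L (fun v => Large ι j k (D₁ v) (E₁ v)) (fun v => Large ι j k (D₂ v) (E₂ v)) := by
  have hD' := hD.lift.lift (D₁ := fun v => D₁ fun a => v (some a))
    (D₂ := fun v => D₂ fun a => v (some a))
  have hE' := hE.lift.lift (D₁ := fun v => E₁ fun a => v (some a))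
    (D₂ := fun v => E₂ fun a => v (some a))
  exact .ex (.ex (.and (hD'.internalCard (D₁ := fun v => D₁ fun a => v (some (some a)))
    (D₂ := fun v => D₂ fun a => v (some (some a))) (.var _)) (.and
    (hE'.internalCard (D₁ := fun v => E₁ fun a => v (some (some a)))
    (D₂ := fun v => E₂ fun a => v (some (some a))) (.var _))
    (.le (.mul (.numeral j) (.var _)) (.mul (.numeral k) (.var _))))))

end ArithmeticCorrespondence

/-! ### The arithmetical notions in the standard model -/

section Standard

variable {L : FirstOrder.Language.{u, v}} (ι : peano →ᴸ L) [L.Structure ℕ] [ι.IsExpansionOn ℕ]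

theorem zero_nat : zero ι = 0 := ι.map_onFunction PeanoFunc.zero _

theorem succ_nat (x : ℕ) : succ ι x = x + 1 := ι.map_onFunction PeanoFunc.succ _

theorem add_nat (x y : ℕ) : add ι x y = x + y := ι.map_onFunction PeanoFunc.add _

theorem mul_nat (x y : ℕ) : mul ι x y = x * y := ι.map_onFunction PeanoFunc.mul _

theorem le_nat (x y : ℕ) : le ι x y ↔ x ≤ y := by
  simp only [le, add_nat]
  exact ⟨fun ⟨z, h⟩ => by lia, fun h => ⟨y - x, by lia⟩⟩

theorem lt_nat (x y : ℕ) : lt ι x y ↔ x < y := by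
  simp only [lt, add_nat, succ_nat]
  exact ⟨fun ⟨z, h⟩ => by lia, fun h => ⟨y - x - 1, by lia⟩⟩

theorem numeral_nat (k : ℕ) : numeral ι k = k := by
  induction k with
  | zero => exact zero_nat ι
  | succ k ih => rw [numeral, ih, succ_nat]

theorem pairRel_nat (c d b : ℕ) : PairRel ι c d b ↔ Nat.pair c d = b := by
  simp only [PairRel, lt_nat, le_nat, add_nat, mul_nat, Nat.pair]
  split_ifs with h <;> lia

theorem entry_nat (b i y : ℕ) : Entry ι b i y ↔ Nat.beta b i = y := by
  simp only [Entry, pairRel_nat, lt_nat, add_nat, mul_nat, succ_nat, Nat.beta]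
  constructor
  · rintro ⟨c, d, q, rfl, hc, hy⟩
    rw [Nat.unpair_pair]
    dsimp only
    rw [hc, Nat.mul_add_mod_self_right, Nat.mod_eq_of_lt hy]
  · rintro rfl
    refine ⟨b.unpair.1, b.unpair.2, b.unpair.1 / ((i + 1) * b.unpair.2 + 1), Nat.pair_unpair b,
      (Nat.div_add_mod' _ _).symm, Nat.mod_lt _ (Nat.succ_pos _)⟩

theorem exists_beta_eq (f : ℕ → ℕ) (m : ℕ) : ∃ b, ∀ x < m, Nat.beta b x = f x := by
  refine ⟨Nat.unbeta (List.ofFn fun i : Fin m => f i), fun x hx => ?_⟩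
  have := Nat.beta_unbeta_coe (List.ofFn fun i : Fin m => f i) ⟨x, by simpa using hx⟩
  simpa using this

/-- A code of a bijection makes `D` equinumerous with an initial segment, hence finite; conversely
an enumeration of a finite set is a finite function, which Gödel's `β` codes. -/
theorem internalCard_nat (D : ℕ → Prop) (n : ℕ) :
    InternalCard ι D n ↔ {x | D x}.Finite ∧ {x | D x}.ncard = n := by
  simp only [InternalCard, entry_nat, lt_nat]
  constructor
  · rintro ⟨b, h₁, h₂, h₃⟩
    have hb : Set.BijOn (Nat.beta b) {x | D x} (Set.Iio n) := by
      refine ⟨fun x hx => ?_, fun x hx x' hx' h => h₂ x x' _ hx hx' rfl h.symm, fun y hy => ?_⟩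
      · obtain ⟨y, rfl, hy⟩ := h₁ x hx
        exact hy
      · exact h₃ y hy
    refine ⟨hb.finite_iff_finite.2 (Set.finite_Iio n), ?_⟩
    rw [← hb.injOn.ncard_image, hb.image_eq, Set.ncard_Iio_nat]
  · rintro ⟨hD, rfl⟩
    have := hD.to_subtype
    let e : {x | D x} ≃ Fin {x | D x}.ncard := (Finite.equivFin _)
    classical
    obtain ⟨m, hm⟩ := hD.bddAbove
    -- The bound `m` may itself lie in `D`, whence `m + 1`; the value `0` off `D` is never read.
    obtain ⟨b, hb⟩ := exists_beta_eq (fun x => if h : D x then e ⟨x, h⟩ else 0) (m + 1)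
    have hb' : ∀ x (h : D x), Nat.beta b x = e ⟨x, h⟩ := fun x h => by
      rw [hb x (Nat.lt_succ_of_le (hm h)), dif_pos h]
    refine ⟨b, fun x hx => ⟨_, hb' x hx, (e _).2⟩, fun x x' y hx hx' h h' => ?_, fun y hy => ?_⟩
    · rw [hb' x hx] at h
      rw [hb' x' hx', ← h, Fin.val_inj] at h'
      simpa using (e.injective h').symm
    · exact ⟨_, (e.symm ⟨y, hy⟩).2, by rw [hb' _ (e.symm ⟨y, hy⟩).2]; simp⟩

end Standard

/-! ### Counting facts for finite sets, in transferable form -/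

section Transfer

variable {L : FirstOrder.Language.{u, v}} (ι : peano →ᴸ L)

/-- Properties of the internal counting of the elements of two subsets `U` and `V` of `Ω`. -/
def CountingFacts {N : Type*} [L.Structure N] (Ω U V : N → Prop) (j k : ℕ) : Prop :=
  (∃ m, ∀ x, Ω x → lt ι x m) → (∀ x, U x → Ω x) → (∀ x, V x → Ω x) →
    (∃ n, InternalCard ι U n) ∧
    (∀ m n, InternalCard ι U m → InternalCard ι U n → m = n) ∧
    (∃ b, ∀ x, Ω x → (U x ↔ Entry ι b x (zero ι))) ∧
    ((∀ x, ¬U x) → Small ι k U Ω) ∧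
    ((∀ x, U x → V x) → Small ι k V Ω → Small ι k U Ω) ∧
    (Small ι (k + k) U Ω → Small ι (k + k) V Ω → Small ι k (fun x => U x ∨ V x) Ω) ∧
    Large ι 0 k U Ω ∧
    (Large ι j k V Ω → (∀ x, V x → U x) → ¬Small ι k (fun x => U x ∧ ¬V x) Ω →
      Large ι (j + 1) k U Ω) ∧
    ((∃ x, Ω x) → ¬Large ι (k + 1) k U Ω)

/-- Boundedness of `Ω` and the two inclusions are premises inside `CountingFacts`. Hence this holds
for arbitrary predicates, as transfer needs: the formulas that define the sets in `M` may define
anything when their parameters range over `ℕ`. -/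
theorem countingFacts_nat [L.Structure ℕ] [ι.IsExpansionOn ℕ] (Ω U V : ℕ → Prop) (j k : ℕ) :
    CountingFacts ι Ω U V j k := by
  rintro ⟨m, hm⟩ hU hV
  simp only [lt_nat] at hm
  have fΩ : {x | Ω x}.Finite := (Set.finite_Iio m).subset hm
  have fU : {x | U x}.Finite := fΩ.subset hU
  have fV : {x | V x}.Finite := fΩ.subset hV
  have small (k : ℕ) (D : ℕ → Prop) (hD : {x | D x}.Finite) :
      Small ι k D Ω ↔ k * {x | D x}.ncard ≤ {x | Ω x}.ncard := by
    simp [Small, internalCard_nat, hD, fΩ, le_nat, mul_nat, numeral_nat]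
  have large (j k : ℕ) (D : ℕ → Prop) (hD : {x | D x}.Finite) :
      Large ι j k D Ω ↔ j * {x | Ω x}.ncard ≤ k * {x | D x}.ncard := by
    simp [Large, internalCard_nat, hD, fΩ, le_nat, mul_nat, numeral_nat]
  have le {D E : ℕ → Prop} (hE : {x | E x}.Finite) (h : ∀ x, D x → E x) :
      {x | D x}.ncard ≤ {x | E x}.ncard := Set.ncard_le_ncard h hE
  refine ⟨by simp [internalCard_nat, fU], fun n n' => ?_, ?_, fun h => ?_, fun h => ?_, ?_, ?_, ?_,
    ?_⟩
  · rw [internalCard_nat, internalCard_nat]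
    exact fun h h' => h.2.symm.trans h'.2
  · classical
    -- A subset is coded by a function that vanishes exactly on it.
    obtain ⟨b, hb⟩ := exists_beta_eq (fun x => if U x then 0 else 1) m
    refine ⟨b, fun x hx => ?_⟩
    rw [entry_nat, hb x (hm x hx), zero_nat]
    split_ifs with h <;> simp [h]
  · rw [small k U fU]
    simp [h]
  · rw [small k U fU, small k V fV]
    exact (Nat.mul_le_mul_left k (le fV h)).trans
  · rw [small _ U fU, small _ V fV, small k (fun x => U x ∨ V x) (fU.union fV)]
    have : {x | U x ∨ V x}.ncard ≤ {x | U x}.ncard + {x | V x}.ncard := Set.ncard_union_le _ _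
    have := Nat.mul_le_mul_left k this
    intro h h'
    lia
  · rw [large _ _ U fU]
    simp
  · rw [large _ _ U fU, large _ _ V fV, small k _ (fU.subset fun x h => h.1)]
    intro h h' h''
    have : {x | U x ∧ ¬V x}.ncard + {x | V x}.ncard = {x | U x}.ncard :=
      Set.ncard_sdiff_add_ncard_of_subset h' fU
    rw [← this]
    lia
  · rintro ⟨x, hx⟩
    rw [large _ _ U fU]
    have h₁ := Nat.mul_le_mul_left k (le fΩ hU)
    have h₂ : 0 < {x | Ω x}.ncard := (Set.ncard_pos fΩ).2 ⟨x, hx⟩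
    lia

variable {ι} {N₁ N₂ : Type*} [L.Structure N₁] [L.Structure N₂] {α : Type*}
  {Ω₁ U₁ V₁ : (α → N₁) → N₁ → Prop} {Ω₂ U₂ V₂ : (α → N₂) → N₂ → Prop}

theorem Corr.countingFacts
    (hΩ : Corr L (fun v : Option α → N₁ => Ω₁ (fun a => v (some a)) (v none))
      (fun v : Option α → N₂ => Ω₂ (fun a => v (some a)) (v none)))
    (hU : Corr L (fun v : Option α → N₁ => U₁ (fun a => v (some a)) (v none))
      (fun v : Option α → N₂ => U₂ (fun a => v (some a)) (v none)))
    (hV : Corr L (fun v : Option α → N₁ => V₁ (fun a => v (some a)) (v none))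
      (fun v : Option α → N₂ => V₂ (fun a => v (some a)) (v none))) (j k : ℕ) :
    Corr L (fun v => CountingFacts ι (Ω₁ v) (U₁ v) (V₁ v) j k)
      (fun v => CountingFacts ι (Ω₂ v) (U₂ v) (V₂ v) j k) := by
  have hUV := hU.or hV
  have hUV' := hU.and hV.not
  have hU' := hU.lift.lift (D₁ := fun v => U₁ fun a => v (some a))
    (D₂ := fun v => U₂ fun a => v (some a))
  refine .imp (.ex (.all (.imp (hΩ.app (fun a => some (some a)) (.var _))
    (.lt (.var _) (.var _))))) (.imp (.all (.imp hU hΩ)) (.imp (.all (.imp hV hΩ)) ?_))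
  refine .and (.ex (hU.lift.internalCard (D₁ := fun v => U₁ fun a => v (some a))
    (D₂ := fun v => U₂ fun a => v (some a)) (.var _))) (.and ?_ (.and ?_ (.and ?_
    (.and ?_ (.and ?_ (.and ?_ (.and ?_ ?_)))))))
  · exact .all (.all (.imp (hU'.internalCard (D₁ := fun v => U₁ fun a => v (some (some a)))
      (D₂ := fun v => U₂ fun a => v (some (some a))) (.var _))
      (.imp (hU'.internalCard (D₁ := fun v => U₁ fun a => v (some (some a)))
      (D₂ := fun v => U₂ fun a => v (some (some a))) (.var _)) (.eq (.var _) (.var _)))))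
  · exact .ex (.all (.imp (hΩ.app (fun a => some (some a)) (.var _)) (.iff
      (hU.app (fun a => some (some a)) (.var _)) (.entry (.var _) (.var _) (.zero ι)))))
  · exact .imp (.all hU.not) (hU.small hΩ k)
  · exact .imp (.all (.imp hU hV)) (.imp (hV.small hΩ k) (hU.small hΩ k))
  · exact .imp (hU.small hΩ _) (.imp (hV.small hΩ _) (hUV.small (D₁ := fun v x => U₁ v x ∨ V₁ v x)
      (D₂ := fun v x => U₂ v x ∨ V₂ v x) hΩ k))
  · exact hU.large hΩ 0 k
  · exact .imp (hV.large hΩ j k) (.imp (.all (.imp hV hU)) (.imp (.not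
      (hUV'.small (D₁ := fun v x => U₁ v x ∧ ¬V₁ v x) (D₂ := fun v x => U₂ v x ∧ ¬V₂ v x) hΩ k))
      (hU.large hΩ (j + 1) k)))
  · exact .imp (.ex hΩ) (.not (hU.large hΩ (k + 1) k))

end Transfer

/-! ### Definability with parameters, and the transferred facts -/

section Definability

variable {L : FirstOrder.Language.{u, v}} {M : Type w} [L.Structure M]

/-- `P` is definable with parameters: the relation is defined by a formula with constants
for the elements of `M`. -/
abbrev Def (L : FirstOrder.Language.{u, v}) [L.Structure M] {α : Type*} (P : (α → M) → Prop) :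
    Prop :=
  Corr L[[(Set.univ : Set M)]] P P

theorem definable_iff_def {α : Type*} {s : Set (α → M)} :
    (Set.univ : Set M).Definable L s ↔ Def L (· ∈ s) := by
  constructor
  · rintro ⟨φ, rfl⟩
    exact ⟨φ, fun _ => Iff.rfl, fun _ => Iff.rfl⟩
  · rintro ⟨φ, h, -⟩
    exact ⟨φ, Set.ext fun v => (h v).symm⟩

theorem definable₁_iff_def {s : Set M} :
    (Set.univ : Set M).Definable₁ L s ↔ Def L (fun v : Unit → M => v () ∈ s) := by
  rw [Set.Definable₁, definable_iff_def]
  constructor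
  · exact fun h => h.comp fun _ => ()
  · exact fun h => h.comp fun _ => 0

/-- Symbols of the language `L`, seen in the language with parameters. -/
abbrev withParams (ι : peano →ᴸ L) (M : Type w) : peano →ᴸ L[[(Set.univ : Set M)]] :=
  (L.lhomWithConstants (Set.univ : Set M)).comp ι

theorem numeral_withParams (ι : peano →ᴸ L) (k : ℕ) :
    (numeral (withParams ι M) k : M) = numeral ι k := by
  induction k with
  | zero => rfl
  | succ k ih => exact congrArg (succ ι) ih

/-- Parameters from `M` have no meaning in `N`, so they become free variables, one for each element
of `M`; the valuation `Subtype.val` restores them. -/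
theorem exists_corr_of_definable (N : Type*) [L.Structure N] {s : Set M}
    (hs : (Set.univ : Set M).Definable₁ L s) :
    ∃ (D₁ : (↥(Set.univ : Set M) → N) → N → Prop) (D₂ : (↥(Set.univ : Set M) → M) → M → Prop),
      Corr L (fun v : Option (Set.univ : Set M) → N => D₁ (fun a => v (some a)) (v none))
        (fun v : Option (Set.univ : Set M) → M => D₂ (fun a => v (some a)) (v none)) ∧
      ∀ x, D₂ Subtype.val x ↔ x ∈ s := by
  obtain ⟨φ, hφ⟩ := Set.definable_iff_exists_formula_sum.1 hs
  refine ⟨fun v x => φ.Realize (Sum.elim v fun _ => x),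
    fun v x => φ.Realize (Sum.elim v fun _ => x),
    ⟨φ.relabel (Sum.elim some fun _ => none), fun v => ?_, fun v => ?_⟩, fun x => ?_⟩
  · rw [Formula.realize_relabel, Sum.comp_elim]
    rfl
  · rw [Formula.realize_relabel, Sum.comp_elim]
    rfl
  · exact (Set.ext_iff.1 hφ fun _ => x).symm

theorem Def.subst₂ {R : M → M → Prop} (h : Def L fun v : Bool → M => R (v false) (v true))
    {β : Type*} {f g : (β → M) → M} (hf : (Set.univ : Set M).DefinableFun L f)
    (hg : (Set.univ : Set M).DefinableFun L g) : Def L fun v => R (f v) (g v) :=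
  definable_iff_def.1 (((definable_iff_def
    (s := {v : Bool → M | R (v false) (v true)})).2 h).preimage_map
      (F := fun v b => cond b (g v) (f v)) fun | true => hg | false => hf)

theorem def_mem {D : Set M} (hD : (Set.univ : Set M).Definable₁ L D) {β : Type*}
    {f : (β → M) → M} (hf : (Set.univ : Set M).DefinableFun L f) : Def L fun v => f v ∈ D :=
  definable_iff_def.1 (Set.Definable.preimage_map (F := fun v _ => f v) (fun _ => hf) hD)

variable [L.Structure ℕ] (ι : peano →ᴸ L) [ι.IsExpansionOn ℕ]

theorem countingFacts (hM : L.ElementarilyEquivalent ℕ M) {Ω U V : Set M}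
    (hΩ : (Set.univ : Set M).Definable₁ L Ω)
    (hU : (Set.univ : Set M).Definable₁ L U) (hV : (Set.univ : Set M).Definable₁ L V) (j k : ℕ) :
    CountingFacts ι (· ∈ Ω) (· ∈ U) (· ∈ V) j k := by
  obtain ⟨Ω₁, Ω₂, cΩ, eΩ⟩ := exists_corr_of_definable ℕ hΩ
  obtain ⟨U₁, U₂, cU, eU⟩ := exists_corr_of_definable ℕ hU
  obtain ⟨V₁, V₂, cV, eV⟩ := exists_corr_of_definable ℕ hV
  have := (cΩ.countingFacts (ι := ι) cU cV j k).transfer hM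
    (fun v => countingFacts_nat ι _ _ _ j k) Subtype.val
  rwa [show Ω₂ Subtype.val = (· ∈ Ω) from funext fun x => propext (eΩ x),
    show U₂ Subtype.val = (· ∈ U) from funext fun x => propext (eU x),
    show V₂ Subtype.val = (· ∈ V) from funext fun x => propext (eV x)] at this

theorem existsUnique_entry (hM : L.ElementarilyEquivalent ℕ M) (b i : M) : ∃! y, Entry ι b i y := by
  have h : Corr L (fun v : Bool → ℕ => ∃ y, Entry ι (v true) (v false) y ∧
      ∀ z, Entry ι (v true) (v false) z → z = y) (fun v : Bool → M => ∃ y,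
      Entry ι (v true) (v false) y ∧ ∀ z, Entry ι (v true) (v false) z → z = y) :=
    .ex (.and (.entry (.var _) (.var _) (.var _))
      (.all (.imp (.entry (.var _) (.var _) (.var _)) (.eq (.var _) (.var _)))))
  exact h.transfer hM (by simp [entry_nat]) (fun t => cond t b i)

/-- Since `n` is standard, the bounded quantifier is a finite conjunction, and the values `f i` are
the free variables of the transferred formula. -/
theorem exists_entry_eq (hM : L.ElementarilyEquivalent ℕ M) (n : ℕ) (f : ℕ → M) :
    ∃ b, ∀ i < n, Entry ι b (numeral ι i) (f i) := by
  have h : Corr L (fun v : ℕ → ℕ => ∃ b, ∀ i < n, Entry ι b (numeral ι i) (v i))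
      (fun v : ℕ → M => ∃ b, ∀ i < n, Entry ι b (numeral ι i) (v i)) :=
    .ex (.forall_lt n fun i => .entry (.var _) (.numeral i) (.var _))
  exact h.transfer hM (fun v => by simpa [entry_nat, numeral_nat] using exists_beta_eq v n) f

end Definability

/-! ### Saturation for countable families of definable sets -/

section Saturation

variable {L : FirstOrder.Language.{u, v}} {M : Type w} [L.Structure M]

/-- Countably many definable sets with the finite intersection property have a common element. -/
theorem Aleph1Saturated.exists_forall_mem (hsat : Aleph1Saturated L M) {κ : Type*} [Countable κ]
    (D : κ → Set M) (hD : ∀ i, (Set.univ : Set M).Definable₁ L (D i))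
    (hfin : ∀ s : Finset κ, ∃ x, ∀ i ∈ s, x ∈ D i) : ∃ x, ∀ i, x ∈ D i := by
  classical
  -- Each set uses finitely many parameters, so the whole family uses countably many.
  choose A hA hAD using fun i => Set.definable_iff_finitely_definable.1 (hD i)
  have hC : ∀ i, (⋃ i, (A i : Set M)).Definable L {x : Fin 1 → M | x 0 ∈ D i} := fun i =>
    (hAD i).mono (Set.subset_iUnion (fun i => (A i : Set M)) i)
  choose φ hφ using hC
  have hφ' (i x) : (φ i).Realize (fun _ => x) ↔ x ∈ D i := (Set.ext_iff.1 (hφ i) fun _ => x).symm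
  obtain ⟨x, hx⟩ := hsat _ (Set.countable_iUnion fun i => (A i).countable_toSet) (Set.range φ)
    fun Φ hΦ => by
      choose g hg using fun B (hB : B ∈ Φ) => hΦ hB
      obtain ⟨x, hx⟩ := hfin (Φ.attach.image fun B : Φ => g B.1 B.2)
      refine ⟨x, fun B hB => ?_⟩
      rw [← hg B hB, hφ']
      exact hx _ (Finset.mem_image_of_mem (fun B : Φ => g B.1 B.2) (Finset.mem_attach Φ ⟨B, hB⟩))
  exact ⟨x, fun i => (hφ' i x).1 (hx _ ⟨i, rfl⟩)⟩

end Saturation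

/-! ### Internal counting of events -/

section Counting

variable {L : FirstOrder.Language.{u, v}} {M : Type w} [L.Structure M]

theorem mem_events_iff {Ω : Set M} (hΩ : (Set.univ : Set M).Definable₁ L Ω) {U : Set Ω} :
    U ∈ events L Ω ↔ (Set.univ : Set M).Definable₁ L (Subtype.val '' U) := by
  constructor
  · rintro ⟨D, hD, rfl⟩
    rw [Subtype.image_preimage_coe]
    exact Set.Definable.inter hΩ hD
  · exact fun h => ⟨_, h, (Set.preimage_image_eq U Subtype.val_injective).symm⟩

variable (ι : peano →ᴸ L) [L.Structure ℕ] [ι.IsExpansionOn ℕ]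

/-- The value at `i` of the function coded by `b`. -/
noncomputable def entryAt (hM : L.ElementarilyEquivalent ℕ M) (b i : M) : M :=
  (existsUnique_entry ι hM b i).choose

variable {ι}

theorem entry_iff (hM : L.ElementarilyEquivalent ℕ M) {b i y : M} :
    Entry ι b i y ↔ entryAt ι hM b i = y :=
  ⟨fun h => ((existsUnique_entry ι hM b i).choose_spec.2 _ h).symm,
    fun h => h ▸ (existsUnique_entry ι hM b i).choose_spec.1⟩

theorem codes_iff (hM : L.ElementarilyEquivalent ℕ M) {Ω : Set M} {b : M} {α : Ω → M} :
    Codes ι b α ↔ (fun ω : Ω => entryAt ι hM b ω) = α := by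
  simp only [Codes, entry_iff hM, funext_iff]

theorem hasMCard_iff (hM : L.ElementarilyEquivalent ℕ M) {Ω : Set M} {U : Set Ω} {n : M} :
    HasMCard ι U n ↔ InternalCard ι (· ∈ Subtype.val '' U) n := by
  simp only [HasMCard, InternalCard, entry_iff hM, codes_iff hM, exists_eq_left']
  refine exists_congr fun b => ⟨fun h => ⟨?_, ?_, ?_⟩, fun ⟨h₁, h₂, h₃⟩ => ⟨?_, ?_, ?_⟩⟩
  · rintro _ ⟨ω, hω, rfl⟩
    exact h.mapsTo hω
  · rintro _ _ _ ⟨ω, hω, rfl⟩ ⟨ω', hω', rfl⟩ h₁ h₂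
    exact congrArg _ (h.injOn hω hω' (h₁.trans h₂.symm))
  · intro y hy
    obtain ⟨ω, hω, rfl⟩ := h.surjOn hy
    exact ⟨ω, ⟨ω, hω, rfl⟩, rfl⟩
  · intro ω hω
    exact h₁ ω ⟨ω, hω, rfl⟩
  · exact fun ω hω ω' hω' h => Subtype.ext (h₂ _ _ _ ⟨ω, hω, rfl⟩ ⟨ω', hω', rfl⟩ rfl h.symm)
  · intro y hy
    obtain ⟨_, ⟨ω, hω, rfl⟩, rfl⟩ := h₃ y hy
    exact ⟨ω, hω, rfl⟩

variable (ι) in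
/-- `k |U| ≤ |Ω|` in the sense of `M`. -/
def SmallIn {Ω : Set M} (k : ℕ) (U : Set Ω) : Prop :=
  Small ι k (· ∈ Subtype.val '' U) (· ∈ Ω)

variable {Ω : Set M} {U V : Set Ω}

theorem countingFacts_events (hM : L.ElementarilyEquivalent ℕ M) (hΩ : MFinite ι Ω)
    (hU : U ∈ events L Ω) (hV : V ∈ events L Ω) (j k : ℕ) :
    type_of% (countingFacts ι hM hΩ.1 ((mem_events_iff hΩ.1).1 hU)
      ((mem_events_iff hΩ.1).1 hV) j k hΩ.2 (by simp +contextual) (by simp +contextual)) :=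
  countingFacts ι hM hΩ.1 ((mem_events_iff hΩ.1).1 hU)
      ((mem_events_iff hΩ.1).1 hV) j k hΩ.2 (by simp +contextual) (by simp +contextual)

/-- The cardinalities on the right may a priori vary with `k`; their uniqueness removes the
difference. The right-hand side is a countable list of definable conditions, which is the form that
saturation accepts. -/
theorem infinitesimal_iff (hM : L.ElementarilyEquivalent ℕ M) (hΩ : MFinite ι Ω)
    (hU : U ∈ events L Ω) : Infinitesimal ι U ↔ ∀ k, SmallIn ι k U := by
  have huniq := (countingFacts_events hM hΩ hU hU 0 0).2.1
  have huniq' := (countingFacts_events hM hΩ (events L Ω).top_mem hU 0 0).2.1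
  have e : (· ∈ Subtype.val '' (Set.univ : Set Ω)) = (· ∈ Ω) := by simp
  simp only [Set.top_eq_univ, e] at huniq'
  simp only [Infinitesimal, hasMCard_iff hM, SmallIn, Small, e]
  constructor
  · rintro ⟨m, n, hm, hn, h⟩ k
    exact ⟨m, n, hm, hn, h k⟩
  · intro h
    obtain ⟨m, n, hm, hn, -⟩ := h 0
    refine ⟨m, n, hm, hn, fun k => ?_⟩
    obtain ⟨m', n', hm', hn', hk⟩ := h k
    rwa [huniq _ _ hm hm', huniq' _ _ hn hn']

theorem exists_code (hM : L.ElementarilyEquivalent ℕ M) (hΩ : MFinite ι Ω)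
    (hU : U ∈ events L Ω) : ∃ b, ∀ ω : Ω, ω ∈ U ↔ entryAt ι hM b ω = zero ι := by
  obtain ⟨b, hb⟩ := (countingFacts_events hM hΩ hU hU 0 0).2.2.1
  refine ⟨b, fun ω => ?_⟩
  rw [← entry_iff, ← hb ω ω.2]
  simp

theorem smallIn_empty (hM : L.ElementarilyEquivalent ℕ M) (hΩ : MFinite ι Ω) (k : ℕ) :
    SmallIn ι k (∅ : Set Ω) :=
  (countingFacts_events hM hΩ (events L Ω).bot_mem (events L Ω).bot_mem 0 k).2.2.2.1 (by simp)

theorem SmallIn.mono (hM : L.ElementarilyEquivalent ℕ M) (hΩ : MFinite ι Ω)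
    (hU : U ∈ events L Ω) (hV : V ∈ events L Ω) {k : ℕ} (h : SmallIn ι k V) (hUV : U ⊆ V) :
    SmallIn ι k U :=
  (countingFacts_events hM hΩ hU hV 0 k).2.2.2.2.1 (Set.image_mono hUV) h

theorem SmallIn.union (hM : L.ElementarilyEquivalent ℕ M) (hΩ : MFinite ι Ω)
    (hU : U ∈ events L Ω) (hV : V ∈ events L Ω) {k : ℕ} (h : SmallIn ι (k + k) U)
    (h' : SmallIn ι (k + k) V) : SmallIn ι k (U ∪ V) := by
  have := (countingFacts_events hM hΩ hU hV 0 k).2.2.2.2.2.1 h h'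
  rwa [SmallIn, Set.image_union]

/-- A directed family of events has elements that are maximal up to sets of size `|Ω| / k`. -/
theorem exists_almost_maximal (hM : L.ElementarilyEquivalent ℕ M) (hΩ : MFinite ι Ω)
    (hne : Ω.Nonempty) {E : Set (Set Ω)} (hE : ∀ U ∈ E, U ∈ events L Ω) (hE' : E.Nonempty)
    (hdir : ∀ U ∈ E, ∀ V ∈ E, ∃ W ∈ E, U ∪ V ⊆ W) (k : ℕ) :
    ∃ U ∈ E, ∀ V ∈ E, SmallIn ι k (V \ U) := by
  by_contra! hcon
  -- If no member is almost maximal, each member can be enlarged within `E` by more than `|Ω| / k`.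
  -- After `j` enlargements `j |Ω| ≤ k |U|`, which is absurd for `j = k + 1`.
  have key (j : ℕ) : ∃ U ∈ E, Large ι j k (· ∈ Subtype.val '' U) (· ∈ Ω) := by
    induction j with
    | zero =>
      obtain ⟨U, hU⟩ := hE'
      exact ⟨U, hU, (countingFacts_events hM hΩ (hE U hU) (hE U hU) 0 k).2.2.2.2.2.2.1⟩
    | succ j ih =>
      obtain ⟨U, hU, hj⟩ := ih
      obtain ⟨V, hV, hUV⟩ := hcon U hU
      obtain ⟨W, hW, hW'⟩ := hdir U hU V hV
      have hsub : V \ U ⊆ W \ U := Set.sdiff_subset_sdiff_left (Set.union_subset_iff.1 hW').2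
      refine ⟨W, hW, (countingFacts_events hM hΩ (hE W hW) (hE U hU) j k).2.2.2.2.2.2.2.1 hj
        (Set.image_mono (Set.union_subset_iff.1 hW').1) fun h => hUV ?_⟩
      have h' : SmallIn ι k (W \ U) := by
        rwa [SmallIn, Set.image_sdiff Subtype.val_injective]
      exact h'.mono hM hΩ ((events L Ω).sdiff_mem (hE V hV) (hE U hU))
        ((events L Ω).sdiff_mem (hE W hW) (hE U hU)) hsub
  obtain ⟨U, hU, h⟩ := key (k + 1)
  exact (countingFacts_events hM hΩ (hE U hU) (hE U hU) 0 k).2.2.2.2.2.2.2.2 hne h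

end Counting

/-! ### The truth algebra: order, maximal events, countable meets -/

section TruthAlgebra

variable {L : FirstOrder.Language.{u, v}} {M : Type w} [L.Structure M]

/-- `eventClass` as a homomorphism of Boolean algebras. -/
def eventClassHom (ι : peano →ᴸ L) (Ω : Set M) :
    BoundedLatticeHom (events L Ω) (TruthAlgebra ι Ω) where
  toFun := eventClass ι
  map_sup' U V := by
    -- The quotient map respects sums and products of the Boolean ring, so the join is written by
    -- means of these.
    have h : U ⊔ V = symmDiff (symmDiff U V) (U ⊓ V) := (symmDiff_symmDiff_inf U V).symm
    rw [h]
    refine ofBoolAlg.injective ?_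
    rw [ofBoolAlg_sup]
    simp only [eventClass, toBoolRing_symmDiff, toBoolRing_inf, map_add, map_mul,
      ofBoolAlg_toBoolAlg]
  map_inf' U V := rfl
  map_top' := rfl
  map_bot' := rfl

theorem eventClass_surjective (ι : peano →ᴸ L) (Ω : Set M) :
    Function.Surjective (eventClass ι (Ω := Ω)) := fun b => by
  obtain ⟨a, ha⟩ := Ideal.Quotient.mk_surjective (ofBoolAlg b)
  exact ⟨ofBoolRing a, congrArg toBoolAlg ha⟩

theorem def_smallIn {ι : peano →ᴸ L} {Ω : Set M} (hΩ : MFinite ι Ω) {β : Type*}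
    (S : (β → M) → Set Ω)
    (hS : Def L fun v : Option β → M => v none ∈ Subtype.val '' S fun a => v (some a)) (k : ℕ) :
    Def L fun v => SmallIn ι k (S v) := by
  have h := Corr.small (ι := withParams ι M) (D₁ := fun v x => x ∈ Subtype.val '' S v)
    (D₂ := fun v x => x ∈ Subtype.val '' S v) (E₁ := fun _ x => x ∈ Ω) (E₂ := fun _ x => x ∈ Ω)
    hS (def_mem hΩ.1 (.proj L)) k
  simp only [Small, numeral_withParams] at h
  exact h

variable [L.Structure ℕ] {ι : peano →ᴸ L} [ι.IsExpansionOn ℕ] {Ω : Set M} {U V : Set Ω}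

theorem Infinitesimal.mono (hM : L.ElementarilyEquivalent ℕ M) (hΩ : MFinite ι Ω)
    (hU : U ∈ events L Ω) (hV : V ∈ events L Ω) (h : Infinitesimal ι V) (hUV : U ⊆ V) :
    Infinitesimal ι U :=
  (infinitesimal_iff hM hΩ hU).2 fun k =>
    ((infinitesimal_iff hM hΩ hV).1 h k).mono hM hΩ hU hV hUV

theorem Infinitesimal.union (hM : L.ElementarilyEquivalent ℕ M) (hΩ : MFinite ι Ω)
    (hU : U ∈ events L Ω) (hV : V ∈ events L Ω) (h : Infinitesimal ι U) (h' : Infinitesimal ι V) :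
    Infinitesimal ι (U ∪ V) :=
  (infinitesimal_iff hM hΩ ((events L Ω).sup_mem hU hV)).2 fun k =>
    ((infinitesimal_iff hM hΩ hU).1 h (k + k)).union hM hΩ hU hV
      ((infinitesimal_iff hM hΩ hV).1 h' (k + k))

theorem infinitesimal_empty (hM : L.ElementarilyEquivalent ℕ M) (hΩ : MFinite ι Ω) :
    Infinitesimal ι (∅ : Set Ω) :=
  (infinitesimal_iff hM hΩ (events L Ω).bot_mem).2 fun k => smallIn_empty hM hΩ k

/-- Infinitesimal events are closed under unions and definable subsets, so generating an ideal adds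
nothing to them. -/
theorem mem_nullIdeal_iff (hM : L.ElementarilyEquivalent ℕ M) (hΩ : MFinite ι Ω)
    (a : AsBoolRing (events L Ω)) : a ∈ nullIdeal ι Ω ↔ Infinitesimal ι (ofBoolRing a).1 := by
  refine ⟨fun h => ?_, fun h => Ideal.subset_span h⟩
  refine Submodule.span_induction (p := fun a _ => Infinitesimal ι (ofBoolRing a).1)
    (fun a h => h) (infinitesimal_empty hM hΩ) (fun a b _ _ ha hb => ?_) (fun a b _ hb => ?_) h
  · rw [ofBoolRing_add]
    refine (ha.union hM hΩ (ofBoolRing a).2 (ofBoolRing b).2 hb).mono hM hΩ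
      (symmDiff (ofBoolRing a) (ofBoolRing b)).2
      ((events L Ω).sup_mem (ofBoolRing a).2 (ofBoolRing b).2) ?_
    exact symmDiff_le_sup (a := ofBoolRing a) (b := ofBoolRing b)
  · rw [smul_eq_mul, ofBoolRing_mul]
    exact hb.mono hM hΩ (ofBoolRing a ⊓ ofBoolRing b).2 (ofBoolRing b).2 Set.inter_subset_right

theorem eventClass_le_iff (hM : L.ElementarilyEquivalent ℕ M) (hΩ : MFinite ι Ω)
    {U V : events L Ω} : eventClass ι U ≤ eventClass ι V ↔ Infinitesimal ι (U.1 \ V.1) := by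
  change eventClassHom ι Ω U ≤ eventClassHom ι Ω V ↔ _
  rw [← sdiff_eq_bot_iff, ← map_sdiff, ← ofBoolAlg_inj, ofBoolAlg_bot]
  exact Ideal.Quotient.eq_zero_iff_mem.trans (mem_nullIdeal_iff hM hΩ _)

theorem definableFun_entryAt (hM : L.ElementarilyEquivalent ℕ M) {β : Type*} {f g : (β → M) → M}
    (hf : (Set.univ : Set M).DefinableFun L f) (hg : (Set.univ : Set M).DefinableFun L g) :
    (Set.univ : Set M).DefinableFun L fun v => entryAt ι hM (f v) (g v) := by
  have h : (Set.univ : Set M).DefinableFun L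
      fun v : Bool → M => entryAt ι hM (v false) (v true) := by
    refine definable_iff_def.2 ?_
    have : Def L fun v : Option Bool → M =>
        Entry (withParams ι M) (v (some false)) (v (some true)) (v none) :=
      .entry (.var _) (.var _) (.var _)
    change Def L fun v : Option Bool → M => Entry ι _ _ _ at this
    simpa only [entry_iff hM] using! this
  exact h.comp (g := fun v b => cond b (g v) (f v)) fun | true => hg | false => hf

/-- Among the events that are parametrized by countably many definable conditions there is a
largest one up to infinitesimal sets, if they form a directed family. -/
theorem exists_maximal (hM : L.ElementarilyEquivalent ℕ M) (hsat : Aleph1Saturated L M)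
    (hΩ : MFinite ι Ω) (hne : Ω.Nonempty) {κ : Type*} [Countable κ] (G : κ → Set M)
    (hG : ∀ i, (Set.univ : Set M).Definable₁ L (G i)) (S : M → Set Ω)
    (hS : Def L fun v : Bool → M => v true ∈ Subtype.val '' S (v false))
    (hne' : ∃ x, ∀ i, x ∈ G i)
    (hdir : ∀ x y, (∀ i, x ∈ G i) → (∀ i, y ∈ G i) → ∃ z, (∀ i, z ∈ G i) ∧ S x ∪ S y ⊆ S z) :
    ∃ x, (∀ i, x ∈ G i) ∧ ∀ y, (∀ i, y ∈ G i) → Infinitesimal ι (S y \ S x) := by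
  have hS' (x : M) : S x ∈ events L Ω := by
    rw [mem_events_iff hΩ.1, definable₁_iff_def]
    exact hS.subst₂ (R := fun x ω => ω ∈ Subtype.val '' S x)
      (L.definableFun_const _ trivial) (.proj L)
  have hdiff (x y : M) : S x \ S y ∈ events L Ω := (events L Ω).sdiff_mem (hS' x) (hS' y)
  have hx (k : ℕ) : ∃ x, (∀ i, x ∈ G i) ∧ ∀ y, (∀ i, y ∈ G i) → SmallIn ι k (S y \ S x) := by
    obtain ⟨_, ⟨x, hx, rfl⟩, h⟩ := exists_almost_maximal hM hΩ hne
      (E := S '' {x | ∀ i, x ∈ G i}) (by rintro _ ⟨x, -, rfl⟩; exact hS' x)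
      (by obtain ⟨x, hx⟩ := hne'; exact ⟨_, x, hx, rfl⟩) (by
        rintro _ ⟨x, hx, rfl⟩ _ ⟨y, hy, rfl⟩
        obtain ⟨z, hz, h⟩ := hdir x y hx hy
        exact ⟨_, ⟨z, hz, rfl⟩, h⟩) k
    exact ⟨x, hx, fun y hy => h _ ⟨y, hy, rfl⟩⟩
  choose x hxG hx using hx
  -- Directedness bounds finitely many of the almost maximal sets exactly; saturation then bounds
  -- all of them, the `k`-th up to `|Ω| / k`.
  have hub (s : Finset ℕ) : ∃ z, (∀ i, z ∈ G i) ∧ ∀ k ∈ s, S (x k) ⊆ S z := by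
    classical
    induction s using Finset.induction_on with
    | empty =>
      obtain ⟨z, hz⟩ := hne'
      exact ⟨z, hz, by simp⟩
    | insert k s _ ih =>
      obtain ⟨z, hz, h⟩ := ih
      obtain ⟨z', hz', h'⟩ := hdir (x k) z (hxG k) hz
      refine ⟨z', hz', fun l hl => ?_⟩
      obtain rfl | hl := Finset.mem_insert.1 hl
      · exact Set.subset_union_left.trans h'
      · exact (h l hl).trans (Set.subset_union_right.trans h')
  obtain ⟨z, hz⟩ := hsat.exists_forall_mem
    (fun i : κ ⊕ ℕ => Sum.elim G (fun k => {z | SmallIn ι k (S (x k) \ S z)}) i) (by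
      rintro (i | k)
      · exact hG i
      · rw [definable₁_iff_def]
        refine def_smallIn hΩ (fun v => S (x k) \ S (v ())) ?_ k
        simp only [Set.image_sdiff Subtype.val_injective]
        exact .and (hS.subst₂ (R := fun x ω => ω ∈ Subtype.val '' S x)
            (L.definableFun_const _ trivial) (.proj L))
          (.not (hS.subst₂ (R := fun x ω => ω ∈ Subtype.val '' S x)
            (.proj L) (.proj L)))) fun s => by
      obtain ⟨z, hz, h⟩ := hub s.toRight
      refine ⟨z, ?_⟩
      rintro (i | k) hi
      · exact hz i
      · change SmallIn ι k (S (x k) \ S z)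
        rw [Set.sdiff_eq_empty.2 (h k (by simpa using hi))]
        exact smallIn_empty hM hΩ k
  have hzG : ∀ i, z ∈ G i := fun i => hz (.inl i)
  refine ⟨z, hzG, fun y hy => (infinitesimal_iff hM hΩ (hdiff _ _)).2 fun k => ?_⟩
  -- Passing through the approximation of index `2k` splits `S y \ S z` into two pieces of size at
  -- most `|Ω| / 2k`.
  have h₁ : SmallIn ι (k + k) (S y \ S (x (k + k))) := hx (k + k) y hy
  have h₂ : SmallIn ι (k + k) (S (x (k + k)) \ S z) := hz (.inr (k + k))
  refine (h₁.union hM hΩ (hdiff _ _) (hdiff _ _) h₂).mono hM hΩ (hdiff _ _)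
    ((events L Ω).sup_mem (hdiff _ _) (hdiff _ _)) ?_
  intro ω hω
  by_cases h : ω ∈ S (x (k + k))
  · exact .inr ⟨h, hω.2⟩
  · exact .inl ⟨hω.1, h⟩

/-- The truth algebra has countable meets. -/
theorem exists_isGLB (hM : L.ElementarilyEquivalent ℕ M) (hsat : Aleph1Saturated L M)
    (hΩ : MFinite ι Ω) (hne : Ω.Nonempty) {κ : Type*} [Countable κ] (b : κ → TruthAlgebra ι Ω) :
    ∃ U : events L Ω, IsGLB (Set.range b) (eventClass ι U) := by
  choose U hU using fun i => eventClass_surjective ι Ω (b i)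
  obtain rfl : (fun i => eventClass ι (U i)) = b := funext hU
  -- Every event is some `S x`, so events are parametrized by elements of `M`. The lower bounds of
  -- `b` are then cut out by countably many definable conditions and are directed under union, and a
  -- maximal one is the meet.
  let S (x : M) : Set Ω := {ω | entryAt ι hM x ω = zero ι}
  have hS : Def L fun v : Bool → M => v true ∈ Subtype.val '' S (v false) := by
    have : Def L fun v : Bool → M => v true ∈ Ω ∧ entryAt ι hM (v false) (v true) = zero ι :=
      .and (def_mem hΩ.1 (.proj L)) (definable_iff_def.1
        ((definableFun_entryAt hM (.proj L)
          (.proj L)).ofPred_eq_const (A := Set.univ) trivial))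
    have e (v : Bool → M) : (v true ∈ Subtype.val '' S (v false)) =
        (v true ∈ Ω ∧ entryAt ι hM (v false) (v true) = zero ι) := by
      simp [S, and_comm]
    simpa only [e] using this
  have hS' (x : M) : S x ∈ events L Ω := by
    rw [mem_events_iff hΩ.1, definable₁_iff_def]
    exact hS.subst₂ (R := fun x ω => ω ∈ Subtype.val '' S x)
      (L.definableFun_const _ trivial) (.proj L)
  have code (V : Set Ω) (hV : V ∈ events L Ω) : ∃ x, S x = V := by
    obtain ⟨x, hx⟩ := exists_code hM hΩ hV
    exact ⟨x, Set.ext fun ω => (hx ω).symm⟩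
  have hdiff (x : M) (i : κ) : S x \ U i ∈ events L Ω := (events L Ω).sdiff_mem (hS' x) (U i).2
  have hG (x : M) : (∀ i : κ × ℕ, x ∈ {x | SmallIn ι i.2 (S x \ U i.1)}) ↔
      ∀ i, eventClass ι ⟨S x, hS' x⟩ ≤ eventClass ι (U i) := by
    simp only [Prod.forall, Set.mem_ofPred_eq, eventClass_le_iff hM hΩ,
      infinitesimal_iff hM hΩ (hdiff x _)]
  obtain ⟨x, hx, hmax⟩ := exists_maximal hM hsat hΩ hne
    (fun i : κ × ℕ => {x | SmallIn ι i.2 (S x \ U i.1)}) (fun i => by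
      rw [definable₁_iff_def]
      refine def_smallIn hΩ (fun v => S (v ()) \ U i.1) ?_ i.2
      simp only [Set.image_sdiff Subtype.val_injective]
      exact .and (hS.subst₂ (R := fun x ω => ω ∈ Subtype.val '' S x)
          (.proj L) (.proj L))
        (.not (def_mem ((mem_events_iff hΩ.1).1 (U i.1).2) (.proj L)))) S hS (by
      obtain ⟨x, hx⟩ := code ∅ (events L Ω).bot_mem
      refine ⟨x, fun i => ?_⟩
      rw [Set.mem_ofPred_eq, hx, Set.empty_sdiff]
      exact smallIn_empty hM hΩ _) fun x y hx hy => by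
      obtain ⟨z, hz⟩ := code (S x ∪ S y) ((events L Ω).sup_mem (hS' x) (hS' y))
      refine ⟨z, (hG z).2 fun i => ?_, hz.ge⟩
      have : (⟨S z, hS' z⟩ : events L Ω) = ⟨S x, hS' x⟩ ⊔ ⟨S y, hS' y⟩ := Subtype.ext hz
      rw [this]
      exact (map_sup (eventClassHom ι Ω) _ _).trans_le (sup_le ((hG x).1 hx i) ((hG y).1 hy i))
  refine ⟨⟨S x, hS' x⟩, ?_, fun b hb => ?_⟩
  · rintro _ ⟨i, rfl⟩
    exact (hG x).1 hx i
  · obtain ⟨⟨V, hV⟩, rfl⟩ := eventClass_surjective ι Ω b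
    obtain ⟨y, rfl⟩ := code V hV
    exact (eventClass_le_iff hM hΩ).2 (hmax y ((hG y).2 fun i => hb ⟨i, rfl⟩))

end TruthAlgebra

/-! ### Truth sets of open formulas over a compact family -/

section Families

variable {L : FirstOrder.Language.{u, v}} {M : Type w} [L.Structure M]

theorem isQF_subst {α β : Type*} {n : ℕ} {A : L.BoundedFormula α n} (h : A.IsQF)
    (f : α → L.Term β) : (A.subst f).IsQF := by
  induction h with
  | falsum => exact BoundedFormula.IsQF.falsum
  | of_isAtomic h =>
    cases h with
    | equal t₁ t₂ => exact (BoundedFormula.IsAtomic.equal _ _).isQF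
    | rel R ts => exact (BoundedFormula.IsAtomic.rel _ _).isQF
  | imp _ _ ih₁ ih₂ => exact ih₁.imp ih₂

theorem isQF_toFormula {α : Type*} {n : ℕ} {A : L.BoundedFormula α n} (h : A.IsQF) :
    A.toFormula.IsQF := by
  induction h with
  | falsum => exact BoundedFormula.IsQF.falsum
  | of_isAtomic h =>
    cases h with
    | equal t₁ t₂ => exact (BoundedFormula.IsAtomic.equal _ _).isQF
    | rel R ts => exact (BoundedFormula.IsAtomic.rel _ _).isQF
  | imp _ _ ih₁ ih₂ => exact ih₁.imp ih₂

/-- Substitution of definable functions in a formula. -/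
theorem def_realize {γ β : Type*} (φ : L.Formula γ) {G : γ → (β → M) → M}
    (hG : ∀ a, (Set.univ : Set M).DefinableFun L (G a)) :
    Def L fun v => φ.Realize fun a => G a v := by
  classical
  -- Only finitely many variables occur in `φ`, and preimages of definable sets are taken along
  -- finitely many coordinates.
  have e' (w : γ → M) : φ.Realize w ↔
      Formula.Realize (φ.restrictFreeVar (id : φ.freeVarFinset → φ.freeVarFinset)) fun a => w a :=
    (BoundedFormula.realize_restrictFreeVar
      (f := (id : φ.freeVarFinset → φ.freeVarFinset)) (v := fun a => w a) w fun a => rfl).symm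
  simp only [e']
  have h : (∅ : Set M).Definable L (Set.ofPred (Formula.Realize (M := M)
    (φ.restrictFreeVar (id : φ.freeVarFinset → φ.freeVarFinset)))) :=
    Set.empty_definable_iff.2 ⟨_, rfl⟩
  exact definable_iff_def.1 (Set.Definable.preimage_map (β := φ.freeVarFinset)
    (F := fun v a => G a.1 v) (fun a => hG a) (h.mono (Set.empty_subset Set.univ)))

/-- The set of samples at which the formula `B`, with the random variables `z` for its free
variables, is true. -/
def truthSet {Ω : Set M} {F : Set (Ω → M)} {γ : Type*} (B : L[[F]].Formula γ) (z : γ → Ω → M) :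
    Set Ω :=
  {ω | letI := sampleStructure (L := L) F ω
    B.Realize fun a => z a ω}

variable {Ω : Set M} {F : Set (Ω → M)} {γ δ : Type*}

/-- The interpretation of `L(F)` changes with `ω`. Turning the constants into variables leaves one
`L`-formula, evaluated at arguments that depend on `ω`, so truth sets become definable. -/
theorem mem_truthSet_iff {B : L[[F]].Formula γ} {z : γ → Ω → M} {ω : Ω} :
    ω ∈ truthSet B z ↔ Formula.Realize (BoundedFormula.constantsVarsEquiv B)
      (Sum.elim (fun α : F => α.1 ω) fun a => z a ω) := by
  let : L[[F]].Structure M := sampleStructure F ω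
  have : (L.lhomWithConstants F).IsExpansionOn M :=
    let : (constantsOn F).Structure M := constantsOn.structure fun α => (α : Ω → M) ω
    LHom.sumInl_isExpansionOn M
  exact BoundedFormula.realize_constantsVarsEquiv.symm

theorem truthSet_congr {B : L[[F]].Formula γ} {z z' : γ → Ω → M} {ω : Ω}
    (h : ∀ a, z a ω = z' a ω) : ω ∈ truthSet B z ↔ ω ∈ truthSet B z' := by
  simp only [mem_truthSet_iff, h]

theorem truthSet_relabel {B : L[[F]].Formula γ} {e : γ → δ} {z : δ → Ω → M} :
    truthSet (B.relabel e) z = truthSet B fun a => z (e a) := by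
  ext ω
  let := sampleStructure (L := L) F ω
  exact Formula.realize_relabel

variable [L.Structure ℕ] (ι : peano →ᴸ L)

/-- The hypotheses on the ambient model, the sample space and the family of random variables. -/
structure CompactFamily (F : Set (Ω → M)) : Prop where
  equiv : L.ElementarilyEquivalent ℕ M
  saturated : Aleph1Saturated L M
  finite : MFinite ι Ω
  nonempty : Ω.Nonempty
  closed : LClosed L F
  cases : ClosedUnderCases L F
  compact : Compact ι F

variable {ι}

namespace CompactFamily

theorem nonempty_family (h : CompactFamily ι F) : Nonempty F :=
  ⟨⟨_, h.closed 0 (ι.onFunction PeanoFunc.zero) Fin.elim0 fun i => i.elim0⟩⟩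

/-- The closure hypothesis tests a formula at `α` itself. Substituting the constants `z` makes `B` a
sentence with a dummy variable, so the test no longer depends on the functions being glued. -/
theorem exists_cases (h : CompactFamily ι F) {B : L[[F]].Formula γ} (hB : B.IsQF) (z : γ → F)
    (α β : F) : ∃ γ : F, ∀ ω : Ω, (ω ∈ truthSet B (fun a => (z a).1) → γ.1 ω = α.1 ω) ∧
      (ω ∉ truthSet B (fun a => (z a).1) → γ.1 ω = β.1 ω) := by
  obtain ⟨γ, hγ, hγ'⟩ := h.cases α α.2 β β.2
    (BoundedFormula.relabel (Empty.elim : Empty → Empty ⊕ Fin 1)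
      (B.subst fun a => (L.con (z a)).term)) ((isQF_subst hB _).relabel _)
  refine ⟨⟨γ, hγ⟩, fun ω => ?_⟩
  let := sampleStructure (L := L) F ω
  have e : ω ∈ truthSet B (fun a => (z a).1) ↔ (BoundedFormula.relabel
      (Empty.elim : Empty → Empty ⊕ Fin 1) (B.subst fun a => (L.con (z a)).term)).Realize
      Empty.elim fun _ => α.1 ω := by
    rw [BoundedFormula.realize_relabel, BoundedFormula.realize_subst]
    simp only [Term.realize_constants]
    rw [Subsingleton.elim ((fun _ => α.1 ω) ∘ Fin.natAdd 1) (default : Fin 0 → M)]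
    rfl
  rw [e]
  exact hγ' ω

variable [ι.IsExpansionOn ℕ]

theorem exists_code (h : CompactFamily ι F) (α : F) :
    ∃ b, ∀ ω : Ω, entryAt ι h.equiv b ω = α.1 ω := by
  obtain ⟨H, hH, -⟩ := h.compact
  obtain ⟨b, hb, -⟩ := Set.mem_iInter.1 (hH.ge α.2) 0
  exact ⟨b, congrFun ((codes_iff h.equiv).1 hb)⟩

/-- The codes of elements of `F` are given by countably many definable conditions. -/
theorem exists_conditions (h : CompactFamily ι F) :
    ∃ G : ℕ → Set M, (∀ k, (Set.univ : Set M).Definable₁ L (G k)) ∧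
      ∀ b, (∀ k, b ∈ G k) ↔ (fun ω : Ω => entryAt ι h.equiv b ω) ∈ F := by
  obtain ⟨H, hH, -⟩ := h.compact
  -- The code `b` need not satisfy `H` itself: another code of the same function on `Ω` may do so.
  refine ⟨fun k => {b | (fun ω : Ω => entryAt ι h.equiv b ω) ∈
    definedFamily ι Ω H (numeral ι k)}, fun k => ?_, fun b => ?_⟩
  · have hH' : (Set.univ : Set M).Definable L {v : Fin 2 → M | H.Realize v} := by
      refine Set.definable_iff_exists_formula_sum.2 ⟨Formula.relabel
        (Sum.map (fun m => ⟨m, trivial⟩) id) (BoundedFormula.constantsVarsEquiv H), ?_⟩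
      ext v
      rw [Set.mem_ofPred_eq, Set.mem_ofPred_eq, Formula.realize_relabel, Sum.elim_comp_map]
      exact BoundedFormula.realize_constantsVarsEquiv.symm
    rw [definable₁_iff_def]
    simp only [Set.mem_ofPred_eq, definedFamily, codes_iff h.equiv, funext_iff, Subtype.forall]
    refine .ex (.and (.all (.imp (def_mem h.finite.1 (.proj L)) ?_)) ?_)
    · exact definable_iff_def.1 (Set.DefinableFun.ofPred_eq
        (definableFun_entryAt h.equiv (.proj L) (.proj L))
        (definableFun_entryAt h.equiv (.proj L) (.proj L)))
    · exact definable_iff_def.1 (Set.Definable.preimage_map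
        (F := fun (v : Option Unit → M) => ![numeral ι k, v none])
        (fun i => by
          fin_cases i
          · exact L.definableFun_const _ trivial
          · exact .proj L) hH')
  · have := Set.ext_iff.1 hH fun ω : Ω => entryAt ι h.equiv b ω
    rwa [Set.mem_iInter] at this

/-- The random variables live on `Ω` only, whereas definability concerns functions of all `v`; `hz`
therefore compares them just where `f v` is a sample. Constants from `F` are replaced by entries of
their codes. -/
theorem def_truthSet (h : CompactFamily ι F) (B : L[[F]].Formula γ) {β : Type*}
    {f : (β → M) → M} (hf : (Set.univ : Set M).DefinableFun L f) {z : (β → M) → γ → Ω → M}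
    {G : γ → (β → M) → M} (hG : ∀ a, (Set.univ : Set M).DefinableFun L (G a))
    (hz : ∀ v a (ω : Ω), f v = ω → z v a ω = G a v) :
    Def L fun v => f v ∈ Subtype.val '' truthSet B (z v) := by
  choose c hc using h.exists_code
  have e (v : β → M) : (f v ∈ Subtype.val '' truthSet B (z v)) = (f v ∈ Ω ∧
      Formula.Realize (BoundedFormula.constantsVarsEquiv B) fun a : F ⊕ γ =>
        Sum.elim (fun α v => entryAt ι h.equiv (c α) (f v)) G a v) := by
    have e' (ω : Ω) (hω : f v = ω) : (fun a : F ⊕ γ =>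
        Sum.elim (fun α v => entryAt ι h.equiv (c α) (f v)) G a v) =
        Sum.elim (fun α : F => α.1 ω) fun a => z v a ω := by
      funext a
      rcases a with α | a
      · exact (congrArg _ hω).trans (hc α ω)
      · exact (hz v a ω hω).symm
    refine propext ⟨?_, fun ⟨hΩ, hv⟩ => ⟨⟨f v, hΩ⟩, ?_, rfl⟩⟩
    · rintro ⟨ω, hω, hv⟩
      refine ⟨hv ▸ ω.2, ?_⟩
      rw [e' ω hv.symm]
      exact mem_truthSet_iff.1 hω
    · rw [mem_truthSet_iff, ← e' _ rfl]
      exact hv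
  simp only [e]
  refine .and (def_mem h.finite.1 hf) (def_realize _ ?_)
  rintro (α | a)
  · exact definableFun_entryAt h.equiv (L.definableFun_const _ trivial) hf
  · exact hG a

theorem truthSet_mem (h : CompactFamily ι F) (B : L[[F]].Formula γ) (z : γ → F) :
    truthSet B (fun a => (z a).1) ∈ events L Ω := by
  choose c hc using h.exists_code
  rw [mem_events_iff h.finite.1, definable₁_iff_def]
  exact h.def_truthSet B (.proj L) (G := fun a v => entryAt ι h.equiv (c (z a)) (v ()))
    (fun a => definableFun_entryAt h.equiv (L.definableFun_const _ trivial) (.proj L))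
    fun v a ω hω => by rw [hω, hc]

/-- The class in the truth algebra of the set of samples at which `B(z)` is true. -/
def value (h : CompactFamily ι F) (B : L[[F]].Formula γ) (z : γ → F) : TruthAlgebra ι Ω :=
  eventClass ι ⟨_, h.truthSet_mem B z⟩

/-- Finite initial segments are coded in `M` by transfer, and saturation codes the whole external
sequence. -/
theorem exists_code_sequence (h : CompactFamily ι F) (f : ℕ → M) :
    ∃ x, ∀ i, entryAt ι h.equiv x (numeral ι i) = f i := by
  refine h.saturated.exists_forall_mem (fun i => {x | entryAt ι h.equiv x (numeral ι i) = f i})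
    (fun i => ?_) fun s => ?_
  · rw [definable₁_iff_def]
    exact definable_iff_def.1 ((definableFun_entryAt h.equiv (.proj L)
      (L.definableFun_const _ trivial)).ofPred_eq_const (A := Set.univ) trivial)
  · obtain ⟨n, hn⟩ := s.exists_nat_subset_range
    obtain ⟨x, hx⟩ := exists_entry_eq ι h.equiv n f
    exact ⟨x, fun i hi => (entry_iff h.equiv).1 (hx i (Finset.mem_range.1 (hn hi)))⟩

/-- The random variable with index `a` in the countable family of random variables coded by `x`. -/
noncomputable def decode [Encodable γ] (h : CompactFamily ι F) (x : M) (a : γ) (ω : Ω) : M :=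
  entryAt ι h.equiv (entryAt ι h.equiv x (numeral ι (Encodable.encode a))) ω

theorem exists_decode_eq [Encodable γ] (h : CompactFamily ι F) (z : γ → F) :
    ∃ x, ∀ a, h.decode x a = (z a).1 := by
  choose c hc using h.exists_code
  have := h.nonempty_family
  obtain ⟨x, hx⟩ := h.exists_code_sequence
    -- Indices that encode no element of `γ` receive the irrelevant value zero.
    (fun i => ((Encodable.decode₂ γ i).map fun a => c (z a)).getD (zero ι))
  exact ⟨x, fun a => funext fun ω => by simp [decode, hx, hc]⟩

theorem definableFun_decode [Encodable γ] (h : CompactFamily ι F) (a : γ) {β : Type*}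
    {f g : (β → M) → M} (hf : (Set.univ : Set M).DefinableFun L f)
    (hg : (Set.univ : Set M).DefinableFun L g) :
    (Set.univ : Set M).DefinableFun L fun v => entryAt ι h.equiv
      (entryAt ι h.equiv (f v) (numeral ι (Encodable.encode a))) (g v) :=
  definableFun_entryAt h.equiv (definableFun_entryAt h.equiv hf
    (L.definableFun_const _ trivial)) hg

/-- The codes of countable families of elements of `F` are given by countably many definable
conditions. -/
theorem exists_conditions_sequence [Encodable γ] (h : CompactFamily ι F) :
    ∃ G : γ × ℕ → Set M, (∀ k, (Set.univ : Set M).Definable₁ L (G k)) ∧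
      ∀ x, (∀ k, x ∈ G k) ↔ ∀ a : γ, h.decode x a ∈ F := by
  obtain ⟨G, hG, hG'⟩ := h.exists_conditions
  refine ⟨fun i => {x | entryAt ι h.equiv x (numeral ι (Encodable.encode i.1)) ∈ G i.2},
    fun i => ?_, fun x => ?_⟩
  · rw [definable₁_iff_def]
    exact def_mem (hG i.2) (definableFun_entryAt h.equiv (.proj L)
      (L.definableFun_const _ trivial))
  · rw [Prod.forall]
    exact forall_congr' fun a =>
      hG' (entryAt ι h.equiv x (numeral ι (Encodable.encode a)))

/-- The truth value of an open formula, as a function of countably many of its variables, attains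
its maximum. -/
theorem exists_maximal_truthSet [Encodable γ] (h : CompactFamily ι F)
    {B : L[[F]].Formula (δ ⊕ γ)} (hB : B.IsQF) (xs : δ → F) : ∃ z : γ → F, ∀ z' : γ → F,
      h.value B (Sum.elim xs z') ≤ h.value B (Sum.elim xs z) := by
  choose c hc using h.exists_code
  obtain ⟨G, hG, hG'⟩ := h.exists_conditions_sequence (γ := γ)
  let S (x : M) : Set Ω := truthSet B (Sum.elim (fun d => (xs d).1) (h.decode x))
  have hS : Def L fun v : Bool → M => v true ∈ Subtype.val '' S (v false) :=
    h.def_truthSet B (.proj L) (G := Sum.elim (fun d v => entryAt ι h.equiv (c (xs d)) (v true))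
      fun a v => entryAt ι h.equiv
        (entryAt ι h.equiv (v false) (numeral ι (Encodable.encode a))) (v true))
      (by
        rintro (d | a)
        · exact definableFun_entryAt h.equiv (L.definableFun_const _ trivial) (.proj L)
        · exact h.definableFun_decode a (.proj L) (.proj L))
      (by
        rintro v (d | a) ω hω
        · simp [hω, hc]
        · simp [hω, decode])
  have code (z : γ → F) : ∃ x, (∀ k, x ∈ G k) ∧
      S x = truthSet B (fun a => (Sum.elim xs z a).1) := by
    obtain ⟨x, hx⟩ := h.exists_decode_eq z
    refine ⟨x, (hG' x).2 fun a => (hx a).symm ▸ (z a).2, ?_⟩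
    simp only [S]
    congr
    funext a
    rcases a with d | a
    · rfl
    · exact hx a
  have uncode (x : M) (hx : ∀ k, x ∈ G k) : ∃ z : γ → F,
      S x = truthSet B (fun a => (Sum.elim xs z a).1) := by
    refine ⟨fun a => ⟨_, (hG' x).1 hx a⟩, ?_⟩
    simp only [S]
    congr
    funext a
    rcases a with d | a <;> rfl
  obtain ⟨x, hx, hmax⟩ := exists_maximal h.equiv h.saturated h.finite h.nonempty G hG S hS
    (by
      have := h.nonempty_family
      obtain ⟨x, hx, -⟩ := code (Classical.arbitrary _)
      exact ⟨x, hx⟩)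
    (fun x y hx hy => by
      obtain ⟨z, hz⟩ := uncode x hx
      obtain ⟨z', hz'⟩ := uncode y hy
      -- All coordinates are glued by the same test: follow `z` where `B` holds at `z`, and `z'`
      -- elsewhere. So `B` holds at `w` wherever it holds at either tuple.
      choose w hw using fun a => h.exists_cases hB (Sum.elim xs z) (z a) (z' a)
      obtain ⟨t, ht, ht'⟩ := code w
      refine ⟨t, ht, ?_⟩
      rw [hz, hz', ht']
      intro ω hω
      by_cases hzω : ω ∈ truthSet B (fun a => (Sum.elim xs z a).1)
      · refine (truthSet_congr ?_).1 hzω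
        rintro (d | a)
        · rfl
        · exact ((hw a ω).1 hzω).symm
      · refine (truthSet_congr ?_).1 (hω.resolve_left hzω)
        rintro (d | a)
        · rfl
        · exact ((hw a ω).2 hzω).symm)
  obtain ⟨z, hz⟩ := uncode x hx
  refine ⟨z, fun z' => ?_⟩
  obtain ⟨y, hy, hy'⟩ := code z'
  have := hmax y hy
  rw [hz, hy'] at this
  exact (eventClass_le_iff h.equiv h.finite).2 this

end CompactFamily

end Families

/-! ### Truth values of open formulas and finite conjunctions -/

section TruthValues

variable {L : FirstOrder.Language.{u, v}} {M : Type w} [L.Structure M] {ι : peano →ᴸ L} {Ω : Set M}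
  {F : Set (Ω → M)} {n : ℕ} {xs : Fin n → F}

theorem isQF_iInf {L : FirstOrder.Language.{u, v}} {α β : Type*} [Finite β]
    {f : β → L.BoundedFormula α n} (h : ∀ i, (f i).IsQF) : (BoundedFormula.iInf f).IsQF := by
  rw [BoundedFormula.iInf]
  generalize (@Finset.univ β (Fintype.ofFinite β)).toList = l
  induction l with
  | nil => exact BoundedFormula.IsQF.top
  | cons i l ih => exact (h i).inf ih

theorem hasTruthValue_inf {A B : L[[F]].BoundedFormula Empty n} {a b : TruthAlgebra ι Ω}
    (ha : HasTruthValue ι F A xs a) (hb : HasTruthValue ι F B xs b) :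
    HasTruthValue ι F (A ⊓ B) xs (a ⊓ b) := by
  have e : a ⊓ b = ((a ⇨ (b ⇨ ⊥)) ⇨ ⊥) := by simp [himp_eq, inf_comm]
  exact ⟨_, ⊥, ⟨a, _, ha, ⟨b, ⊥, hb, rfl, rfl⟩, rfl⟩, rfl, e⟩

theorem hasTruthValue_iInf {β : Type*} [Finite β] {f : β → L[[F]].BoundedFormula Empty n}
    {b : β → TruthAlgebra ι Ω} (h : ∀ i, HasTruthValue ι F (f i) xs (b i)) {c : TruthAlgebra ι Ω}
    (hc : IsGLB (Set.range b) c) : HasTruthValue ι F (BoundedFormula.iInf f) xs c := by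
  have key (l : List β) : ∃ d, HasTruthValue ι F ((l.map f).foldr (· ⊓ ·) ⊤) xs d ∧
      ∀ e, e ≤ d ↔ ∀ i ∈ l, e ≤ b i := by
    induction l with
    | nil => exact ⟨⊤, ⟨⊥, ⊥, rfl, rfl, by simp⟩, by simp⟩
    | cons i l ih =>
      obtain ⟨d, hd, hd'⟩ := ih
      exact ⟨b i ⊓ d, hasTruthValue_inf (h i) hd, by simp [hd']⟩
  obtain ⟨d, hd, hd'⟩ := key (@Finset.univ β (Fintype.ofFinite β)).toList
  have : d = c := by
    refine IsGLB.unique ⟨?_, fun e he => ?_⟩ hc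
    · rintro _ ⟨i, rfl⟩
      exact (hd' d).1 le_rfl i (by simp)
    · exact (hd' e).2 fun i _ => he ⟨i, rfl⟩
  exact this ▸ hd

theorem isGLB_eventClass {β : Type*} [Finite β] {U : β → events L Ω} {V : events L Ω}
    (hV : V.1 = ⋂ i, (U i).1) : IsGLB (Set.range fun i => eventClass ι (U i)) (eventClass ι V) := by
  have := Fintype.ofFinite β
  have hle : ∀ W : events L Ω, W ≤ V ↔ ∀ i, W ≤ U i := fun W => by
    change W.1 ≤ V.1 ↔ _
    rw [hV]
    exact Set.subset_iInter_iff
  have e : V = Finset.univ.inf U := eq_of_forall_le_iff fun W => by simp [hle]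
  have e' : eventClass ι V = Finset.univ.inf fun i => eventClass ι (U i) := by
    rw [e]
    exact map_finset_inf (eventClassHom ι Ω) _ _
  rw [e']
  refine ⟨?_, fun c hc => Finset.le_inf fun i _ => hc ⟨i, rfl⟩⟩
  rintro _ ⟨i, rfl⟩
  exact Finset.inf_le (f := fun i => eventClass ι (U i)) (Finset.mem_univ i)

/-- The value of an open formula is the class of the set of samples at which it is true. -/
theorem hasTruthValue_of_isQF {A : L[[F]].BoundedFormula Empty n} (hA : A.IsQF)
    (hev : ∀ B : L[[F]].BoundedFormula Empty n, {ω : Ω | letI := sampleStructure (L := L) F ω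
      B.Realize Empty.elim fun i => (xs i).1 ω} ∈ events L Ω) :
    HasTruthValue ι F A xs (eventClass ι ⟨_, hev A⟩) := by
  induction hA with
  | falsum => exact map_bot (eventClassHom ι Ω)
  | @of_isAtomic A h =>
    cases h with
    | equal t₁ t₂ => exact ⟨hev (t₁.bdEqual t₂), rfl⟩
    | rel R ts => exact ⟨hev (R.boundedFormula ts), rfl⟩
  | @imp A B _ _ ihA ihB =>
    refine ⟨_, _, ihA, ihB, ?_⟩
    have : (⟨_, hev (A.imp B)⟩ : events L Ω) = ⟨_, hev A⟩ ⇨ ⟨_, hev B⟩ := by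
      refine Subtype.ext ?_
      rw [BooleanSubalgebra.val_himp, himp_eq]
      ext ω
      exact imp_iff_or_not
    rw [this]
    exact map_himp (eventClassHom ι Ω) _ _

end TruthValues

/-! ### Existential formulas and the saturation inequality -/

namespace CompactFamily

variable {L : FirstOrder.Language.{u, v}} {M : Type w} [L.Structure M] {ι : peano →ᴸ L} {Ω : Set M}
  {F : Set (Ω → M)} {n : ℕ} [L.Structure ℕ] [ι.IsExpansionOn ℕ]

/-- `B` is a matrix of the existential formula `A`: the value of `A` is the largest value of `B`. -/
def HasMatrix (h : CompactFamily ι F) (A : L[[F]].BoundedFormula Empty n)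
    (B : L[[F]].Formula (Fin n ⊕ ℕ)) : Prop :=
  B.IsQF ∧ ∀ (xs : Fin n → F) (ys : ℕ → F),
    (∀ ys' : ℕ → F, h.value B (Sum.elim xs ys') ≤ h.value B (Sum.elim xs ys)) →
      HasTruthValue ι F A xs (h.value B (Sum.elim xs ys))

theorem value_relabel (h : CompactFamily ι F) {γ δ : Type*} (B : L[[F]].Formula γ) (e : γ → δ)
    (z : δ → F) : h.value (B.relabel e) z = h.value B fun a => z (e a) :=
  congrArg _ (Subtype.ext truthSet_relabel)

/-- The join over the outer variable of maxima over the inner witnesses equals the maximum over both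
together. As maxima of open formulas are attained, the joins in the value of an existential formula
exist. -/
theorem exists_hasMatrix (h : CompactFamily ι F) {A : L[[F]].BoundedFormula Empty n}
    (hA : A.IsExistential) : ∃ B, h.HasMatrix A B := by
  induction hA with
  | @of_isQF n A hA =>
    let e : Empty ⊕ Fin n → Fin n ⊕ ℕ := Sum.elim Empty.elim Sum.inl
    refine ⟨A.toFormula.relabel e, (isQF_toFormula hA).relabel _, fun xs ys _ => ?_⟩
    have key (B : L[[F]].BoundedFormula Empty n) : {ω : Ω | letI := sampleStructure (L := L) F ω
        B.Realize Empty.elim fun i => (xs i).1 ω} =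
        truthSet (B.toFormula.relabel e) fun a => (Sum.elim xs ys a).1 := by
      rw [truthSet_relabel]
      ext ω
      let := sampleStructure (L := L) F ω
      have : B.toFormula.Realize (fun a => (Sum.elim xs ys (e a)).1 ω) ↔
          B.Realize Empty.elim fun i => (xs i).1 ω := by
        rw [BoundedFormula.realize_toFormula]
        rw [Subsingleton.elim ((fun a => (Sum.elim xs ys (e a)).1 ω) ∘ Sum.inl) Empty.elim]
        rfl
      exact this.symm
    have := hasTruthValue_of_isQF (ι := ι) hA fun B => (key B).symm ▸ h.truthSet_mem _ _
    simp only [key] at this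
    exact this
  | @ex n A _ ih =>
    obtain ⟨B, hB, hAB⟩ := ih
    -- The newly bound variable becomes witness `0`, and the earlier witnesses move up by one.
    let e : Fin (n + 1) ⊕ ℕ → Fin n ⊕ ℕ :=
      Sum.elim (Fin.snoc (α := fun _ => Fin n ⊕ ℕ) Sum.inl (Sum.inr 0)) fun j => Sum.inr (j + 1)
    have he (xs : Fin n → F) (ys : ℕ → F) : h.value (B.relabel e) (Sum.elim xs ys) =
        h.value B (Sum.elim (Fin.snoc xs (ys 0)) fun j => ys (j + 1)) := by
      rw [value_relabel]
      congr 1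
      funext a
      rcases a with i | j
      · refine Fin.lastCases ?_ (fun i => ?_) i <;> simp [e]
      · rfl
    refine ⟨B.relabel e, hB.relabel _, fun xs ys hys => ?_⟩
    choose w hw using fun α : F => h.exists_maximal_truthSet hB (Fin.snoc xs α)
    refine hasTruthValue_ex.2 ⟨_, fun α => hAB _ _ (hw α), ?_, fun c hc => ?_⟩
    · rintro _ ⟨α, rfl⟩
      -- The competing witness sequence is `α` followed by the best witnesses for `α`.
      refine le_trans (le_of_eq ?_) (hys fun j => j.casesOn α (w α))
      rw [he]
      rfl
    · rw [he]
      exact (hw (ys 0) _).trans (hc ⟨ys 0, rfl⟩)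

theorem exists_maximal_value (h : CompactFamily ι F) {γ : Type*} [Encodable γ]
    {B : L[[F]].Formula γ} (hB : B.IsQF) :
    ∃ z : γ → F, ∀ z' : γ → F, h.value B z' ≤ h.value B z := by
  obtain ⟨z, hz⟩ := h.exists_maximal_truthSet (δ := Empty)
    (B := B.relabel Sum.inr) (hB.relabel _) Empty.elim
  simp only [value_relabel, Sum.elim_inr] at hz
  exact ⟨z, hz⟩

theorem value_le_iff (h : CompactFamily ι F) {γ : Type*} {B : L[[F]].Formula γ} {z : γ → F}
    {U : events L Ω} : eventClass ι U ≤ h.value B z ↔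
      ∀ k, SmallIn ι k (U.1 \ truthSet B fun a => (z a).1) :=
  (eventClass_le_iff h.equiv h.finite).trans
    (infinitesimal_iff h.equiv h.finite ((events L Ω).sdiff_mem U.2 (h.truthSet_mem B z)))

/-- The value of a finite conjunction of open formulas. -/
theorem isGLB_value_iInf (h : CompactFamily ι F) {γ β : Type*} [Finite β]
    (B : β → L[[F]].Formula γ) (z : γ → F) :
    IsGLB (Set.range fun i => h.value (B i) z) (h.value (Formula.iInf B) z) := by
  refine isGLB_eventClass (Set.ext fun ω => ?_)
  rw [Set.mem_iInter]
  let := sampleStructure (L := L) F ω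
  exact Formula.realize_iInf

theorem exists_realizesSatur (h : CompactFamily ι F) (p : Set (L[[F]].BoundedFormula Empty 1))
    (hp : p.Countable) (hex : ∀ A ∈ p, A.IsExistential) : ∃ α : F, RealizesSatur ι F p α := by
  choose B hB using fun A : p => h.exists_hasMatrix (hex A.1 A.2)
  have := hp.toEncodable
  -- Matrices of different formulas share only the variable `x`, so their witnesses can be chosen
  -- independently.
  let e (A : p) : Fin 1 ⊕ ℕ → Fin 1 ⊕ p × ℕ := Sum.map id fun j => (A, j)
  have he (A : p) (z : Fin 1 ⊕ p × ℕ → F) : h.value ((B A).relabel (e A)) z =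
      h.value (B A) (Sum.elim (fun _ => z (.inl 0)) fun j => z (.inr (A, j))) := by
    rw [value_relabel]
    congr 1
    funext a
    rcases a with i | j
    · rw [Subsingleton.elim i 0]
      rfl
    · rfl
  choose w hw using fun (α : F) (A : p) => h.exists_maximal_truthSet (hB A).1 fun _ => α
  let C (Φ : {Φ : Finset (L[[F]].BoundedFormula Empty 1) // ↑Φ ⊆ p}) :
      L[[F]].Formula (Fin 1 ⊕ p × ℕ) :=
    Formula.iInf fun A : Φ.1 => (B ⟨A, Φ.2 A.2⟩).relabel (e ⟨A, Φ.2 A.2⟩)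
  have hC (Φ) : (C Φ).IsQF := isQF_iInf fun A => (hB _).1.relabel _
  choose z hz using fun Φ => h.exists_maximal_value (hC Φ)
  have hs (Φ) : HasTruthValue ι F (BoundedFormula.iInf fun A : Φ.1 => A.1).ex Fin.elim0
      (h.value (C Φ) (z Φ)) := by
    -- Filling each block with the best witnesses for its own formula realizes the value of the
    -- conjunction at `α`, because the blocks are disjoint.
    let y (α : F) : Fin 1 ⊕ p × ℕ → F := Sum.elim (fun _ => α) fun i => w α i.1 i.2
    refine hasTruthValue_ex.2 ⟨fun α => h.value (C Φ) (y α), fun α => ?_, ?_, fun c hc => ?_⟩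
    · refine hasTruthValue_iInf (fun A => ?_) (h.isGLB_value_iInf _ _)
      have hα : (Fin.snoc Fin.elim0 α : Fin 1 → F) = fun _ => α := by
        funext i
        rw [show i = Fin.last 0 from Subsingleton.elim (α := Fin 1) _ _]
        exact Fin.snoc_last (α := fun _ => F) α Fin.elim0
      rw [he, hα]
      exact (hB ⟨A.1, Φ.2 A.2⟩).2 _ _ (hw α _)
    · rintro _ ⟨α, rfl⟩
      exact hz Φ _
    · refine le_trans ?_ (hc ⟨z Φ (.inl 0), rfl⟩)
      refine (h.isGLB_value_iInf _ _).2 ?_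
      rintro _ ⟨A, rfl⟩
      refine ((h.isGLB_value_iInf _ _).1 ⟨A, rfl⟩).trans ?_
      dsimp only
      rw [he, he]
      exact hw _ _ _
  have : Countable {Φ : Finset (L[[F]].BoundedFormula Empty 1) // ↑Φ ⊆ p} := by
    classical
    refine Function.Surjective.countable (α := Finset p)
      (f := fun Φ => ⟨Φ.map (Function.Embedding.subtype _), by simp⟩) fun Φ =>
      ⟨Φ.1.subtype (· ∈ p), Subtype.ext (Finset.subtype_map_of_mem fun A hA => Φ.2 hA)⟩
  obtain ⟨U, hU⟩ := exists_isGLB h.equiv h.saturated h.finite h.nonempty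
    fun Φ => h.value (C Φ) (z Φ)
  obtain ⟨G, hG, hG'⟩ := h.exists_conditions_sequence (γ := Fin 1 ⊕ p × ℕ)
  -- The unknown `x` codes a whole tuple. The conditions say that its entries lie in `F` and that,
  -- for every `A` and `k`, the event `U` exceeds the truth set of the matrix of `A` by at most `|Ω|
  -- / k`. Finitely many of them mention a finite `Φ`, whose maximizer `z Φ` satisfies them.
  obtain ⟨x, hx⟩ := h.saturated.exists_forall_mem
    (fun i : ((Fin 1 ⊕ p × ℕ) × ℕ) ⊕ (p × ℕ) => Sum.elim G (fun i =>
      {x | SmallIn ι i.2 (U.1 \ truthSet ((B i.1).relabel (e i.1)) (h.decode x))}) i) (by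
      rintro (i | ⟨A, k⟩)
      · exact hG i
      · rw [definable₁_iff_def]
        refine def_smallIn h.finite (fun v => U.1 \ truthSet ((B A).relabel (e A))
          (h.decode (v ()))) ?_ k
        simp only [Set.image_sdiff Subtype.val_injective]
        refine .and (def_mem ((mem_events_iff h.finite.1).1 U.2) (.proj L)) (.not ?_)
        exact h.def_truthSet _ (.proj L) (G := fun a v => entryAt ι h.equiv (entryAt ι h.equiv
            (v (some ())) (numeral ι (Encodable.encode a))) (v none))
          (fun a => h.definableFun_decode a (.proj L) (.proj L))
          fun v a ω hω => by rw [hω]; rfl) fun s => by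
      classical
      let Φ : {Φ : Finset (L[[F]].BoundedFormula Empty 1) // ↑Φ ⊆ p} :=
        ⟨s.toRight.image fun i => i.1.1, by
          intro A hA
          obtain ⟨i, -, rfl⟩ := Finset.mem_image.1 (Finset.mem_coe.1 hA)
          exact i.1.2⟩
      obtain ⟨x, hx⟩ := h.exists_decode_eq (z Φ)
      refine ⟨x, ?_⟩
      rintro (i | ⟨A, k⟩) hi
      · exact (hG' x).2 (fun a => (hx a).symm ▸ (z Φ a).2) i
      · have hA : A.1 ∈ Φ.1 := Finset.mem_image.2 ⟨(A, k), by simpa using hi, rfl⟩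
        have hle : eventClass ι U ≤ h.value ((B A).relabel (e A)) (z Φ) :=
          (hU.1 ⟨Φ, rfl⟩).trans ((h.isGLB_value_iInf _ _).1 ⟨⟨A.1, hA⟩, rfl⟩)
        have := h.value_le_iff.1 hle k
        rw [← funext hx] at this
        exact this
  have hxF : ∀ a, h.decode x a ∈ F := (hG' x).1 fun i => hx (.inl i)
  let y : Fin 1 ⊕ p × ℕ → F := fun a => ⟨_, hxF a⟩
  -- The truth value of `A` at `α = y (.inl 0)` is attained at the best witnesses, so it dominates
  -- the value at those found by saturation.
  let t (A : p) := h.value (B A) (Sum.elim (fun _ => y (.inl 0)) (w (y (.inl 0)) A))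
  have hle (A : p) : eventClass ι U ≤ t A := by
    have : eventClass ι U ≤ h.value ((B A).relabel (e A)) y :=
      h.value_le_iff.2 fun k => hx (.inr (A, k))
    rw [he] at this
    exact this.trans (hw _ _ _)
  obtain ⟨R, hR⟩ := exists_isGLB h.equiv h.saturated h.finite h.nonempty t
  refine ⟨y (.inl 0), _, t, eventClass ι U, eventClass ι R, hs, fun A => (hB A).2 _ _ (hw _ A),
    hU, hR, hR.2 ?_⟩
  rintro _ ⟨A, rfl⟩
  exact hle A

end CompactFamily

end RandomForcing

theorem theorem4p2 {L : FirstOrder.Language.{u, v}} [Countable L.Symbols]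
    (ι : RandomForcing.peano →ᴸ L) [L.Structure ℕ] [ι.IsExpansionOn ℕ]
    {M : Type w} [L.Structure M]
    (hM : L.ElementarilyEquivalent ℕ M) (hsat : RandomForcing.Aleph1Saturated L M)
    (Ω : Set M) (hΩ : RandomForcing.MFinite ι Ω) (hinf : Ω.Infinite)
    (F : Set (Ω → M)) (hF : RandomForcing.LClosed L F)
    (hcases : RandomForcing.ClosedUnderCases L F) (hcompact : RandomForcing.Compact ι F)
    (hpair : RandomForcing.HasPairing ι F)
    (p : Set (L[[F]].BoundedFormula Empty 1)) (hp : p.Countable)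
    (hex : ∀ A ∈ p, A.IsExistential) :
    ∃ α : F, RandomForcing.RealizesSatur ι F p α :=
  RandomForcing.CompactFamily.exists_realizesSatur
    ⟨hM, hsat, hΩ, hinf.nonempty, hF, hcases, hcompact⟩ p hp hex
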